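/- **Setting.** Let $A$ and $H$ be compact quantum group algebras, that is, Hopf $*$-algebras over $\mathbb{C}$ which have a two-sided invariant functional $\mathbf{h}$ with $\mathbf{h}(1)=1$ (the Haar functional) such that $\mathbf{h}(a^*a)>0$ for $a\neq 0$. Let $\pi:A\to H$ be a surjective Hopf $*$-algebra map, and $B=A^{\mathrm{co}(H)}=\{b\in A: (\mathrm{id}\otimes\pi)\Delta(b)=b\otimes 1\}$. Let $\mathbf{H}=(B,\Omega^\bullet,\Omega^{(\bullet,\bullet)},\sigma)$ be a CQH-Hermitian space, which means the following. * $\Omega^\bullet$ is a left $A$-covariant differential $*$-calculus over $B=\Omega^0$, of total degree $2n$, finitely generated as a left $B$-module, with $\Omega^\bullet B^+=B^+\Omega^\bullet$ for $B^+=B\cap\ker\varepsilon$. * $\Omega^{(\bullet,\bullet)}$ is an $A$-covariant complex structure for $\Omega^\bullet$, giving $\mathrm{d}=\partial+\overline{\partial}$. * $\sigma$ is a central, real, left $A$-coinvariant $(1,1)$-form such that, with $L(\omega)=\sigma\wedge\omega$, the maps $L^{n-k}:\Omega^k\to\Omega^{2n-k}$ are isomorphisms for $0\le k<n$. * Let $\ast_\sigma$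 be the Hodge map, that is, the unique linear map with $\ast_\sigma(L^j\omega)=(-1)^{k(k+1)/2}\,\mathbf{i}^{a-b}\frac{j!}{(n-j-k)!}L^{n-j-k}\omega$ for $\omega\in\Omega^{(a,b)}$, $k=a+b\le n$, $L^{n-k+1}\omega=0$, $0\le j\le n-k$. Let $g_\sigma$ be the metric, that is, $g_\sigma(\omega,\nu)=\ast_\sigma(\omega\wedge\ast_\sigma(\nu^*))$ for $\omega,\nu$ of the same degree, with forms of different degrees orthogonal. Then, for each $\omega\ne0$, $g_\sigma(\omega,\omega)$ is a non-zero finite sum of elements $b^*b$ with $b\in B$. * $\mathbf{h}(\ast_\sigma(\mathrm{d}\omega))=0$ for all $\omega\in\Omega^{2n-1}$. Endow $\Omega^\bullet$ with the inner product $\langle\omega,\nu\rangle=\mathbf{h}(g_\sigma(\omega,\nu))$, and let $L^2(\Omega^\bullet)$ be its Hilbert space completion. For $a\in A$ let $\|a\|_{\mathrm{red}}$ be the operator norm of right multiplication by $a$ on the completion $L^2(A)$ of $A$ with respect to $\langle a,b\rangle=\mathbf{h}(ab^*)$. **Statement.** 1. For each $\omega\in\Omega^\bullet$ the operator $R_\omega:\Omega^\bullet\to\Omega^\bullet$,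 $\nu\mapsto\nu\wedge\omega$, is bounded, and it is non-zero if $\omega\neq0$. 2. There is a faithful unital algebra representation $\rho:(\Omega^\bullet)^{\mathrm{op}}\to\mathbb{B}(L^2(\Omega^\bullet))$ with $\rho(\omega)(\nu)=R_\omega(\nu)$ for all $\omega,\nu\in\Omega^\bullet$. It is a $*$-map on $B$: $\rho(b^*)=\rho(b)^*$ for all $b\in B$. 3. For each $b\in B$, right multiplication by $b$ is bounded on $A$, and $\|\rho(b)\|\leq\|b\|_{\mathrm{red}}$. 4. Each $T\in\{\mathrm{d},\partial,\overline{\partial}\}$ has an adjoint $T^\dagger$ on $\Omega^\bullet$ with respect to $\langle\cdot,\cdot\rangle$, and for all $b\in B$ the commutators $[T,\rho(b)]$, $[T^\dagger,\rho(b)]$ and $[D_T,\rho(b)]$, where $D_T=T+T^\dagger$ is the corresponding Dirac operator, are bounded operators on $\Omega^\bullet$. -/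

import Mathlib

noncomputable section

namespace CQH

open scoped TensorProduct ComplexOrder

/-! ### Hilbert space completions -/

/-- A positive definite sesquilinear form on a complex vector space, linear in the first variable
and conjugate linear in the second. -/
structure PosForm (E : Type*) [AddCommGroup E] [Module ℂ E] where
  form : E →ₗ[ℂ] E →ₗ⋆[ℂ] ℂ
  pos : ∀ x, x ≠ 0 → 0 < form x x

namespace PosForm

variable {E : Type*} [AddCommGroup E] [Module ℂ E] (F : PosForm E)

theorem nonneg (x : E) : 0 ≤ F.form x x := by
  by_cases h : x = 0
  · simp [h]
  · exact (F.pos x h).le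

/-- Conjugate symmetry follows from positivity, by polarization. -/
theorem conj_symm (x y : E) : (starRingEnd ℂ) (F.form y x) = F.form x y := by
  have im0 : ∀ z, (F.form z z).im = 0 := fun z => (Complex.le_def.1 (F.nonneg z)).2.symm
  have h1 := im0 (x + y)
  have h2 := im0 (x + Complex.I • y)
  simp only [map_add, LinearMap.add_apply, map_smul, map_smulₛₗ, LinearMap.smul_apply, smul_eq_mul,
    Complex.add_im, Complex.add_re, im0, Complex.mul_im, Complex.mul_re, Complex.I_re,
    Complex.I_im, Complex.conj_I, Complex.neg_re, Complex.neg_im] at h1 h2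
  apply Complex.ext
  · simp only [Complex.conj_re]; linarith
  · simp only [Complex.conj_im]; linarith

/-- The vector space `E`, regarded as an inner product space by means of `F`. -/
def Space (_ : PosForm E) : Type _ := E

instance : AddCommGroup F.Space := inferInstanceAs (AddCommGroup E)

instance : Module ℂ F.Space := inferInstanceAs (Module ℂ E)

/-- Mathlib's inner products are conjugate linear in the first variable, so that
`inner ℂ x y = F.form y x`. -/
@[reducible] def core : InnerProductSpace.Core ℂ F.Space where
  inner x y := F.form (show E from y) (show E from x)
  conj_inner_symm x y := F.conj_symm _ _
  re_inner_nonneg x := (Complex.le_def.1 (F.nonneg x)).1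
  add_left x y z := map_add (F.form (show E from z)) (show E from x) (show E from y)
  smul_left x y r := map_smulₛₗ (F.form (show E from y)) r (show E from x)
  definite x hx := by
    by_contra h
    exact (F.pos x h).ne' hx

instance : NormedAddCommGroup F.Space :=
  InnerProductSpace.Core.toNormedAddCommGroup (cd := F.core)

instance : InnerProductSpace ℂ F.Space := InnerProductSpace.ofCore F.core.toCore

/-- The Hilbert space completion of `E` with respect to `F`. -/
abbrev Hilbert : Type _ := UniformSpace.Completion F.Space

/-- The canonical map of `E` into its completion. -/
def toHilbert : E →ₗ[ℂ] F.Hilbert :=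
  (UniformSpace.Completion.toComplₗᵢ (𝕜 := ℂ) (E := F.Space)).toLinearMap ∘ₗ
    (LinearMap.id : E →ₗ[ℂ] E)

theorem inner_toHilbert (x y : E) :
    inner ℂ (F.toHilbert y) (F.toHilbert x) = F.form x y :=
  UniformSpace.Completion.inner_coe (𝕜 := ℂ) (E := F.Space) y x

theorem denseRange_toHilbert : DenseRange F.toHilbert :=
  UniformSpace.Completion.denseRange_coe (α := F.Space)

/-- A linear operator on `E` is bounded with respect to the norm of the inner product. -/
def Bounded (T : E →ₗ[ℂ] E) : Prop :=
  ∃ C : ℝ, ∀ x, ‖F.toHilbert (T x)‖ ≤ C * ‖F.toHilbert x‖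

/-- The continuous extension to the completion of a bounded linear operator on `E`. -/
def extend (T : E →ₗ[ℂ] E) : F.Hilbert →L[ℂ] F.Hilbert :=
  (F.toHilbert ∘ₗ T).extendOfNorm F.toHilbert

theorem extend_toHilbert {T : E →ₗ[ℂ] E} (hT : F.Bounded T) (x : E) :
    F.extend T (F.toHilbert x) = F.toHilbert (T x) :=
  LinearMap.extendOfNorm_eq (f := F.toHilbert ∘ₗ T) F.denseRange_toHilbert hT x

/-- `T` and `S` are adjoint to each other on `E`. -/
def IsAdjoint (T S : E →ₗ[ℂ] E) : Prop := ∀ x y, F.form (T x) y = F.form x (S y)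

theorem IsAdjoint.unique {T S S' : E →ₗ[ℂ] E} (h : F.IsAdjoint T S) (h' : F.IsAdjoint T S') :
    S = S' := by
  ext y
  by_contra hne
  have h0 := F.pos (S y - S' y) (sub_ne_zero.2 hne)
  rw [map_sub, ← h, ← h', sub_self] at h0
  exact lt_irrefl _ h0

open Classical in
/-- The adjoint on `E` of an operator which is adjointable on `E` (and zero for other
operators). -/
def adjoint (T : E →ₗ[ℂ] E) : E →ₗ[ℂ] E :=
  if h : ∃ S, F.IsAdjoint T S then h.choose else 0

theorem isAdjoint_adjoint {T : E →ₗ[ℂ] E} (h : ∃ S, F.IsAdjoint T S) :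
    F.IsAdjoint T (F.adjoint T) := by
  rw [adjoint, dif_pos h]
  exact h.choose_spec

end PosForm

/-! ### Compact quantum group algebras and quantum homogeneous spaces -/

/-- A Haar functional on a Hopf algebra: a normalised linear functional which is invariant on both
sides. -/
structure IsHaar {A : Type*} [Ring A] [HopfAlgebra ℂ A] (h : A →ₗ[ℂ] ℂ) : Prop where
  map_one : h 1 = 1
  left_inv : ∀ a, TensorProduct.rid ℂ A (h.lTensor A (Coalgebra.comul a)) = h a • 1
  right_inv : ∀ a, TensorProduct.lid ℂ A (h.rTensor A (Coalgebra.comul a)) = h a • 1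

/-- A compact quantum group algebra: a Hopf `*`-algebra over `ℂ` which is cosemisimple (it has a
Haar functional) and whose Haar functional is positive. -/
class CQGA (A : Type*) [Ring A] [HopfAlgebra ℂ A] [StarRing A] [StarModule ℂ A] : Prop where
  comul_star : ∀ a : A, Coalgebra.comul (R := ℂ) (star a) = star (Coalgebra.comul (R := ℂ) a)
  exists_haar : ∃ h : A →ₗ[ℂ] ℂ, IsHaar h ∧ ∀ a, a ≠ 0 → 0 < h (star a * a)

section Haar

variable (A : Type*) [Ring A] [HopfAlgebra ℂ A] [StarRing A] [StarModule ℂ A] [CQGA A]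

theorem IsHaar.unique {A : Type*} [Ring A] [HopfAlgebra ℂ A] {h h' : A →ₗ[ℂ] ℂ}
    (hh : IsHaar h) (hh' : IsHaar h') : h = h' := by
  ext a
  have e : h (TensorProduct.rid ℂ A (h'.lTensor A (Coalgebra.comul a)))
      = h' (TensorProduct.lid ℂ A (h.rTensor A (Coalgebra.comul a))) := by
    generalize (Coalgebra.comul a : A ⊗[ℂ] A) = t
    induction t with
    | zero => simp
    | tmul x y => simp [mul_comm]
    | add x y hx hy => simp only [map_add, hx, hy]
  rw [hh'.left_inv, hh.right_inv, map_smul, map_smul, hh.map_one, hh'.map_one] at e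
  simpa using e.symm

/-- The Haar functional of a compact quantum group algebra. -/
def haar : A →ₗ[ℂ] ℂ := (CQGA.exists_haar (A := A)).choose

theorem isHaar_haar : IsHaar (haar A) := (CQGA.exists_haar (A := A)).choose_spec.1

theorem haar_pos {a : A} (ha : a ≠ 0) : 0 < haar A (star a * a) :=
  (CQGA.exists_haar (A := A)).choose_spec.2 a ha

/-- The inner product `⟨a, b⟩ = h (a b*)` on a compact quantum group algebra. -/
def haarForm : PosForm A where
  form := LinearMap.mk₂'ₛₗ (RingHom.id ℂ) (starRingEnd ℂ) (fun a b => haar A (a * star b))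
    (fun a b c => by rw [add_mul, map_add])
    (fun r a b => by rw [smul_mul_assoc, map_smul]; rfl)
    (fun a b c => by rw [star_add, mul_add, map_add])
    (fun r a b => by rw [star_smul, mul_smul_comm, map_smul]; rfl)
  pos a ha := by
    have := haar_pos A (a := star a) (star_ne_zero.2 ha)
    rwa [star_star] at this

/-- The reduced norm of `a`: the operator norm, on the completion `L²(A)`, of right multiplication
by `a`. -/
def redNorm (a : A) : ℝ := ‖(haarForm A).extend (LinearMap.mulRight ℂ a)‖

end Haar

/-- A homogeneous space of compact quantum group algebras, given by a surjective map of Hopf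
`*`-algebras `π : A → H` (a bialgebra map between Hopf algebras preserves the antipodes). -/
structure HomogeneousSpace (A H : Type*)
    [Ring A] [HopfAlgebra ℂ A] [StarRing A] [StarModule ℂ A] [CQGA A]
    [Ring H] [HopfAlgebra ℂ H] [StarRing H] [StarModule ℂ H] [CQGA H] where
  π : A →ₐc[ℂ] H
  surjective : Function.Surjective π
  map_star : ∀ a, π (star a) = star (π a)

section Homogeneous

variable {A H : Type*}
  [Ring A] [HopfAlgebra ℂ A] [StarRing A] [StarModule ℂ A] [CQGA A]
  [Ring H] [HopfAlgebra ℂ H] [StarRing H] [StarModule ℂ H] [CQGA H]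

/-- The right coaction `(id ⊗ π) ∘ Δ` of `H` on `A`. -/
def HomogeneousSpace.rightCoaction (Q : HomogeneousSpace A H) : A →ₐ[ℂ] A ⊗[ℂ] H :=
  (Algebra.TensorProduct.map (AlgHom.id ℂ A) (Q.π : A →ₐ[ℂ] H)).comp (Bialgebra.comulAlgHom ℂ A)

theorem HomogeneousSpace.rightCoaction_star (Q : HomogeneousSpace A H) (a : A) :
    Q.rightCoaction (star a) = star (Q.rightCoaction a) := by
  simp only [HomogeneousSpace.rightCoaction, AlgHom.comp_apply, Bialgebra.comulAlgHom_apply,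
    CQGA.comul_star]
  generalize (Coalgebra.comul a : A ⊗[ℂ] A) = t
  induction t with
  | zero => simp
  | tmul x y => simpa using congrArg (fun z => (star x) ⊗ₜ[ℂ] z) (Q.map_star y)
  | add x y hx hy => simp only [star_add, map_add, hx, hy]

/-- The quantum homogeneous space `B = A^{co(H)}` of coinvariant elements. -/
def HomogeneousSpace.coinv (Q : HomogeneousSpace A H) : StarSubalgebra ℂ A where
  __ := AlgHom.equalizer Q.rightCoaction (Algebra.TensorProduct.includeLeft : A →ₐ[ℂ] A ⊗[ℂ] H)
  star_mem' {a} ha := by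
    change Q.rightCoaction (star a) = star a ⊗ₜ[ℂ] (1 : H)
    change Q.rightCoaction a = a ⊗ₜ[ℂ] (1 : H) at ha
    rw [Q.rightCoaction_star, ha]
    simp

end Homogeneous

/-! ### Differential calculi, complex and Hermitian structures -/

/-- A differential `*`-calculus over a `*`-algebra `B`. -/
structure DiffStarCalculus (B Ω : Type*) [Ring B] [Algebra ℂ B] [StarRing B]
    [Ring Ω] [Algebra ℂ Ω] where
  deg : ℕ → Submodule ℂ Ω
  [graded : GradedAlgebra deg]
  d : Ω →ₗ[ℂ] Ω
  d_mem : ∀ k, ∀ ω ∈ deg k, d ω ∈ deg (k + 1)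
  d_d : ∀ ω, d (d ω) = 0
  leibniz : ∀ k, ∀ ω ∈ deg k, ∀ ν, d (ω * ν) = d ω * ν + (-1 : ℂ) ^ k • (ω * d ν)
  /-- the identification of `B` with the forms of degree zero -/
  incl : B →ₐ[ℂ] Ω
  incl_injective : Function.Injective incl
  range_incl : LinearMap.range incl.toLinearMap = deg 0
  /-- the calculus is generated in degree zero -/
  generated : Algebra.adjoin ℂ ((deg 0 : Set Ω) ∪ d '' (deg 0 : Set Ω)) = ⊤
  /-- the `*`-map of the calculus -/
  conj : Ω →ₗ⋆[ℂ] Ω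
  conj_incl : ∀ b, conj (incl b) = incl (star b)
  conj_conj : ∀ ω, conj (conj ω) = ω
  conj_d : ∀ ω, d (conj ω) = conj (d ω)
  conj_mul : ∀ k l, ∀ ω ∈ deg k, ∀ ν ∈ deg l,
    conj (ω * ν) = (-1 : ℂ) ^ (k * l) • (conj ν * conj ω)

attribute [instance] DiffStarCalculus.graded

section Calculus

variable {B Ω : Type*} [Ring B] [Algebra ℂ B] [StarRing B] [Ring Ω] [Algebra ℂ Ω]

/-- The identification of `Ω⁰` with `B`, precomposed with the projection of `Ω` onto `Ω⁰`. -/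
def DiffStarCalculus.toBase (C : DiffStarCalculus B Ω) : Ω →ₗ[ℂ] B :=
  (LinearEquiv.ofInjective C.incl.toLinearMap C.incl_injective).symm.toLinearMap ∘ₗ
    (GradedAlgebra.proj C.deg 0).codRestrict (LinearMap.range C.incl.toLinearMap)
      (fun ω => by rw [C.range_incl, GradedAlgebra.proj_apply]; exact SetLike.coe_mem _)

theorem DiffStarCalculus.incl_toBase (C : DiffStarCalculus B Ω) (ω : Ω) :
    C.incl (C.toBase ω) = GradedAlgebra.proj C.deg 0 ω := by
  have := LinearEquiv.apply_symm_apply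
    (LinearEquiv.ofInjective C.incl.toLinearMap C.incl_injective)
    ((GradedAlgebra.proj C.deg 0).codRestrict (LinearMap.range C.incl.toLinearMap)
      (fun ω => by rw [C.range_incl, GradedAlgebra.proj_apply]; exact SetLike.coe_mem _) ω)
  exact congrArg Subtype.val this

/-- A complex structure for a differential `*`-calculus. -/
structure ComplexStructure (C : DiffStarCalculus B Ω) where
  bideg : ℕ × ℕ → Submodule ℂ Ω
  [bigraded : GradedAlgebra bideg]
  deg_eq : ∀ k, C.deg k = ⨆ (p : ℕ × ℕ) (_ : p.1 + p.2 = k), bideg p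
  conj_mem : ∀ a b ω, ω ∈ bideg (a, b) ↔ C.conj ω ∈ bideg (b, a)
  integrable : ∀ a b, ∀ ω ∈ bideg (a, b), C.d ω ∈ bideg (a + 1, b) ⊔ bideg (a, b + 1)

attribute [instance] ComplexStructure.bigraded

namespace ComplexStructure

variable {C : DiffStarCalculus B Ω} (S : ComplexStructure C)

/-- The linear map on `Ω` which is `f a b` on `(a, b)`-forms. -/
def piecewise (f : ℕ → ℕ → Ω →ₗ[ℂ] Ω) : Ω →ₗ[ℂ] Ω :=
  DirectSum.toModule ℂ (ℕ × ℕ) Ω (fun p => f p.1 p.2 ∘ₗ (S.bideg p).subtype) ∘ₗ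
    (DirectSum.decomposeLinearEquiv S.bideg).toLinearMap

theorem piecewise_apply (f : ℕ → ℕ → Ω →ₗ[ℂ] Ω) {a b : ℕ} {ω : Ω} (h : ω ∈ S.bideg (a, b)) :
    S.piecewise f ω = f a b ω := by
  lift ω to S.bideg (a, b) using h
  simp only [piecewise, LinearMap.comp_apply, LinearEquiv.coe_coe,
    DirectSum.decomposeLinearEquiv_apply, DirectSum.decompose_coe]
  exact DirectSum.toModule_lof (M := fun p => S.bideg p) ℂ (a, b) ω

/-- The holomorphic part `∂` of the exterior derivative. -/
def del : Ω →ₗ[ℂ] Ω :=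
  S.piecewise fun a b => GradedAlgebra.proj S.bideg (a + 1, b) ∘ₗ C.d

/-- The antiholomorphic part `∂̄` of the exterior derivative. -/
def delBar : Ω →ₗ[ℂ] Ω :=
  S.piecewise fun a b => GradedAlgebra.proj S.bideg (a, b + 1) ∘ₗ C.d

end ComplexStructure

/-- An Hermitian structure for a differential `*`-calculus of total degree `2n`. -/
structure HermitianStructure (C : DiffStarCalculus B Ω) extends ComplexStructure C where
  n : ℕ
  deg_top : C.deg (2 * n) ≠ ⊥
  deg_gt : ∀ k, 2 * n < k → C.deg k = ⊥
  σ : Ω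
  σ_mem : σ ∈ bideg (1, 1)
  σ_real : C.conj σ = σ
  σ_central : ∀ ω, σ * ω = ω * σ
  lefschetz_bijOn : ∀ k, k < n →
    Set.BijOn (fun ω => σ ^ (n - k) * ω) (C.deg k) (C.deg (2 * n - k))

namespace HermitianStructure

variable {C : DiffStarCalculus B Ω} (S : HermitianStructure C)

/-- The Lefschetz operator `ω ↦ σ ∧ ω`. -/
def lefschetz : Module.End ℂ Ω := LinearMap.mulLeft ℂ S.σ

/-- The space `P^{(a,b)}` of primitive `(a,b)`-forms. -/
def prim (a b : ℕ) : Submodule ℂ Ω :=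
  if a + b ≤ S.n then S.bideg (a, b) ⊓ LinearMap.ker (S.lefschetz ^ (S.n - (a + b) + 1)) else ⊥

/-- The defining property of the Hodge map. (For `j > n - k` one has `L^j ω = 0`, so that the formula
is only meaningful, and only imposed, for `j ≤ n - k`.) -/
def IsHodge (f : Ω →ₗ[ℂ] Ω) : Prop :=
  ∀ a b j, a + b + j ≤ S.n → ∀ ω ∈ S.prim a b,
    f ((S.lefschetz ^ j) ω) =
      ((-1 : ℂ) ^ ((a + b) * (a + b + 1) / 2) * Complex.I ^ ((a : ℤ) - (b : ℤ)) *
        ((j.factorial : ℂ) / ((S.n - j - (a + b)).factorial : ℂ))) •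
      (S.lefschetz ^ (S.n - j - (a + b))) ω

theorem lefschetz_pow_apply (m : ℕ) (ω : Ω) : (S.lefschetz ^ m) ω = S.σ ^ m * ω := by
  rw [lefschetz, LinearMap.pow_mulLeft]; rfl

theorem σ_pow_mem (m : ℕ) : S.σ ^ m ∈ S.bideg (m, m) := by
  have := SetLike.pow_mem_graded m S.σ_mem
  simpa using this

theorem bideg_le (a b : ℕ) : S.bideg (a, b) ≤ C.deg (a + b) := by
  rw [S.deg_eq]
  exact le_iSup₂_of_le (a, b) rfl le_rfl

theorem lefschetz_pow_mem (m : ℕ) {a b : ℕ} {ω : Ω} (h : ω ∈ S.bideg (a, b)) :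
    (S.lefschetz ^ m) ω ∈ S.bideg (m + a, m + b) := by
  rw [lefschetz_pow_apply]
  exact SetLike.mul_mem_graded (S.σ_pow_mem m) h

theorem proj_lefschetz_pow (m a b : ℕ) (ω : Ω) :
    GradedAlgebra.proj S.bideg (m + a, m + b) ((S.lefschetz ^ m) ω) =
      (S.lefschetz ^ m) (GradedAlgebra.proj S.bideg (a, b) ω) := by
  simp only [lefschetz_pow_apply, GradedAlgebra.proj_apply]
  exact DirectSum.coe_decompose_mul_add_of_left_mem S.bideg (i := (m, m)) (j := (a, b))
    (S.σ_pow_mem m)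

theorem proj_mem (p : ℕ × ℕ) (ω : Ω) : GradedAlgebra.proj S.bideg p ω ∈ S.bideg p := by
  rw [GradedAlgebra.proj_apply]; exact SetLike.coe_mem _

theorem proj_of_mem {p : ℕ × ℕ} {ω : Ω} (h : ω ∈ S.bideg p) :
    GradedAlgebra.proj S.bideg p ω = ω := by
  rw [GradedAlgebra.proj_apply]; exact DirectSum.decompose_of_mem_same _ h

theorem proj_of_mem_ne {p q : ℕ × ℕ} {ω : Ω} (h : ω ∈ S.bideg p) (hne : p ≠ q) :
    GradedAlgebra.proj S.bideg q ω = 0 := by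
  rw [GradedAlgebra.proj_apply]; exact DirectSum.decompose_of_mem_ne _ h hne

theorem eq_zero_of_gt {a b : ℕ} {ω : Ω} (h : ω ∈ S.bideg (a, b)) (hlt : 2 * S.n < a + b) :
    ω = 0 := by
  have := S.bideg_le a b h
  rwa [S.deg_gt _ hlt, Submodule.mem_bot] at this

theorem lefschetz_injective {a b : ℕ} (hab : a + b ≤ S.n) {ω : Ω} (h : ω ∈ S.bideg (a, b))
    (h0 : (S.lefschetz ^ (S.n - (a + b))) ω = 0) : ω = 0 := by
  rcases hab.eq_or_lt with he | hlt
  · simpa [he] using h0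
  · rw [lefschetz_pow_apply] at h0
    exact (S.lefschetz_bijOn _ hlt).injOn (S.bideg_le a b h) (Submodule.zero_mem _)
      (by simpa using h0)

/-- The primitive forms of bidegree `p.1` on which the power `p.2` of the Lefschetz operator is
considered in the Lefschetz decomposition. -/
def piece (p : (ℕ × ℕ) × ℕ) : Submodule ℂ Ω :=
  if p.1.1 + p.1.2 + p.2 ≤ S.n then S.prim p.1.1 p.1.2 else ⊥

theorem mem_prim {a b : ℕ} {ω : Ω} (h : ω ∈ S.prim a b) :
    ω ∈ S.bideg (a, b) ∧ (S.lefschetz ^ (S.n - (a + b) + 1)) ω = 0 := by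
  rw [prim] at h
  split_ifs at h with hle
  · exact ⟨h.1, h.2⟩
  · rw [Submodule.mem_bot] at h
    subst h
    exact ⟨Submodule.zero_mem _, map_zero _⟩

/-- The map assembling a form from its Lefschetz components. -/
def assemble : (DirectSum ((ℕ × ℕ) × ℕ) fun p => S.piece p) →ₗ[ℂ] Ω :=
  DirectSum.toModule ℂ _ Ω fun p => (S.lefschetz ^ p.2) ∘ₗ (S.piece p).subtype

theorem pow_mem_range {a b j : ℕ} (h : a + b + j ≤ S.n) {ω : Ω} (hω : ω ∈ S.prim a b) :
    (S.lefschetz ^ j) ω ∈ LinearMap.range S.assemble := by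
  refine ⟨DirectSum.lof ℂ _ (fun p => S.piece p) ((a, b), j) ⟨ω, ?_⟩, ?_⟩
  · simpa [piece, h] using hω
  · rw [assemble, DirectSum.toModule_lof]; rfl

/-- Every `(a, b)`-form of degree at most `n` is the sum of a primitive form and of `L η`. -/
theorem exists_prim_add {a b : ℕ} (hab : a + b ≤ S.n) {ω : Ω} (hω : ω ∈ S.bideg (a, b)) :
    ω ∈ S.prim a b ∨ ∃ a' b', a = a' + 1 ∧ b = b' + 1 ∧
      ∃ η ∈ S.bideg (a', b'), ω - S.lefschetz η ∈ S.prim a b := by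
  have hL := S.lefschetz_pow_mem (S.n - (a + b) + 1) hω
  by_cases hk : a + b < 2
  · left
    rw [prim, if_pos hab]
    exact ⟨hω, S.eq_zero_of_gt hL (by omega)⟩
  obtain ⟨η, hη, he⟩ := (S.lefschetz_bijOn (a + b - 2) (by omega)).surjOn
    (show (S.lefschetz ^ (S.n - (a + b) + 1)) ω ∈ C.deg (2 * S.n - (a + b - 2)) from by
      have := S.bideg_le _ _ hL
      convert this using 2
      omega)
  replace he : (S.lefschetz ^ (S.n - (a + b) + 2)) η = (S.lefschetz ^ (S.n - (a + b) + 1)) ω := by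
    rw [lefschetz_pow_apply, ← he]
    have : S.n - (a + b - 2) = S.n - (a + b) + 2 := by omega
    simp only [this]
  have hp := congrArg (GradedAlgebra.proj S.bideg
    (S.n - (a + b) + 1 + a, S.n - (a + b) + 1 + b)) he
  rw [S.proj_of_mem hL] at hp
  by_cases hpos : 1 ≤ a ∧ 1 ≤ b
  · right
    obtain ⟨a', rfl⟩ := Nat.exists_eq_add_of_le' hpos.1
    obtain ⟨b', rfl⟩ := Nat.exists_eq_add_of_le' hpos.2
    refine ⟨a', b', rfl, rfl, GradedAlgebra.proj S.bideg (a', b') η, S.proj_mem _ _, ?_⟩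
    rw [prim, if_pos hab]
    have hmem := S.lefschetz_pow_mem 1 (S.proj_mem (a', b') η)
    rw [pow_one, add_comm 1 a', add_comm 1 b'] at hmem
    refine ⟨Submodule.sub_mem _ hω hmem, ?_⟩
    rw [SetLike.mem_coe, LinearMap.mem_ker, map_sub, ← hp, sub_eq_zero,
      ← Module.End.mul_apply (S.lefschetz ^ _) S.lefschetz, ← pow_succ, ← S.proj_lefschetz_pow]
    have hq : (S.n - (a' + 1 + (b' + 1)) + 1 + (a' + 1), S.n - (a' + 1 + (b' + 1)) + 1 + (b' + 1)) =
        (S.n - (a' + 1 + (b' + 1)) + 1 + 1 + a', S.n - (a' + 1 + (b' + 1)) + 1 + 1 + b') := by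
      rw [Prod.mk.injEq]; omega
    rw [hq]
  · left
    rw [prim, if_pos hab]
    refine ⟨hω, ?_⟩
    rw [SetLike.mem_coe, LinearMap.mem_ker, ← hp, lefschetz_pow_apply, GradedAlgebra.proj_apply]
    refine DirectSum.coe_decompose_mul_of_left_mem_of_not_le S.bideg
      (S.σ_pow_mem _) ?_
    rw [Prod.mk_le_mk]
    omega

theorem pow_mem_range_of_mem (a : ℕ) : ∀ b i, a + b + i ≤ S.n → ∀ ω ∈ S.bideg (a, b),
    (S.lefschetz ^ i) ω ∈ LinearMap.range S.assemble := by
  induction a with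
  | zero =>
    intro b i h ω hω
    rcases S.exists_prim_add (by omega) hω with hp | ⟨a', b', ha, -⟩
    · exact S.pow_mem_range h hp
    · omega
  | succ a ih =>
    intro b i h ω hω
    rcases S.exists_prim_add (by omega) hω with hp | ⟨a', b', ha, hb, η, hη, hp⟩
    · exact S.pow_mem_range h hp
    · obtain rfl : a = a' := by omega
      subst hb
      have h1 := S.pow_mem_range h hp
      have h2 := ih b' (i + 1) (by omega) η hη
      rw [map_sub, ← Module.End.mul_apply, ← pow_succ] at h1
      simpa using Submodule.add_mem _ h1 h2

theorem assemble_surjective : Function.Surjective S.assemble := by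
  rw [← LinearMap.range_eq_top, eq_top_iff,
    ← (DirectSum.Decomposition.isInternal S.bideg).submodule_iSup_eq_top]
  refine iSup_le fun ⟨a, b⟩ ω hω => ?_
  by_cases h : a + b ≤ S.n
  · simpa using S.pow_mem_range_of_mem a b 0 (by omega) ω hω
  by_cases h2 : 2 * S.n < a + b
  · rw [S.eq_zero_of_gt hω h2]; exact Submodule.zero_mem _
  obtain ⟨η, hη, he⟩ := (S.lefschetz_bijOn (2 * S.n - (a + b)) (by omega)).surjOn
    (show ω ∈ C.deg (2 * S.n - (2 * S.n - (a + b))) from by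
      have := S.bideg_le _ _ hω
      convert this using 2
      omega)
  have key : C.deg (2 * S.n - (a + b)) ≤ (LinearMap.range S.assemble).comap
      (S.lefschetz ^ (S.n - (2 * S.n - (a + b)))) := by
    rw [S.deg_eq]
    refine iSup₂_le fun ⟨c, e⟩ hc ν hν => ?_
    have hc' : c + e = 2 * S.n - (a + b) := hc
    exact S.pow_mem_range_of_mem c e _ (by omega) ν hν
  have := key hη
  rw [Submodule.mem_comap, lefschetz_pow_apply] at this
  rw [← he]
  exact this

theorem assemble_injective : Function.Injective S.assemble := by
  classical
  let _ : AddCommGroup (DirectSum ((ℕ × ℕ) × ℕ) fun p => S.piece p) :=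
    Module.addCommMonoidToAddCommGroup ℂ
  refine (injective_iff_map_eq_zero S.assemble).2 fun x hx => ?_
  by_contra hne
  obtain ⟨⟨⟨a, b⟩, J⟩, hmem, hmax⟩ := Finset.exists_max_image (DFinsupp.support x) (fun p => p.2)
    (by rwa [Finset.nonempty_iff_ne_empty, ne_eq, DFinsupp.support_eq_empty])
  have hx0 : x ((a, b), J) ≠ 0 := (DFinsupp.mem_support_iff (f := x)).1 hmem
  have hle : a + b + J ≤ S.n := by
    by_contra hcon
    apply hx0
    have h1 := (x ((a, b), J)).2
    simp only [piece, if_neg hcon, Submodule.mem_bot] at h1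
    exact Subtype.ext h1
  have hpr : ∀ p ∈ DFinsupp.support x, p.1.1 + p.1.2 + p.2 ≤ S.n ∧
      ((x p : Ω) ∈ S.prim p.1.1 p.1.2) := by
    intro p hp
    have h1 := (x p).2
    by_cases hcon : p.1.1 + p.1.2 + p.2 ≤ S.n
    · simp only [piece, if_pos hcon] at h1
      exact ⟨hcon, h1⟩
    · simp only [piece, if_neg hcon, Submodule.mem_bot] at h1
      exact absurd (Subtype.ext h1 : x p = 0) ((DFinsupp.mem_support_iff (f := x) (i := p)).1 hp)
  have hsum : S.assemble x = ∑ p ∈ DFinsupp.support x, (S.lefschetz ^ p.2) (x p : Ω) := by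
    conv_lhs => rw [← DirectSum.sum_support_of x]
    rw [map_sum]
    refine Finset.sum_congr rfl fun p _ => ?_
    exact DirectSum.toModule_lof (M := fun p => S.piece p) ℂ p (x p)
  have h2 := congrArg (fun z => (S.lefschetz ^ (S.n - (a + b) - J))
    (GradedAlgebra.proj S.bideg (J + a, J + b) z)) (hsum.symm.trans hx)
  simp only [map_sum, map_zero] at h2
  rw [Finset.sum_eq_single_of_mem _ hmem] at h2
  · have hb := (S.mem_prim (hpr _ hmem).2).1
    rw [S.proj_lefschetz_pow, S.proj_of_mem hb, ← Module.End.mul_apply, ← pow_add,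
      Nat.sub_add_cancel (by omega)] at h2
    exact hx0 (Subtype.ext (S.lefschetz_injective (show a + b ≤ S.n by omega) hb h2))
  · rintro ⟨⟨c, e⟩, j⟩ hp hpne
    obtain ⟨hcle, hcp⟩ := hpr _ hp
    have hcp' := S.mem_prim hcp
    have hjJ : j ≤ J := hmax _ hp
    simp only at hcle hcp'
    by_cases heq : (j + c, j + e) = (J + a, J + b)
    · rw [Prod.mk.injEq] at heq
      have hjlt : j < J := by
        refine lt_of_le_of_ne hjJ fun hj => hpne ?_
        subst hj
        rw [Prod.mk.injEq, Prod.mk.injEq]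
        omega
      rw [← heq.1, ← heq.2, S.proj_lefschetz_pow, S.proj_of_mem hcp'.1, ← Module.End.mul_apply,
        ← pow_add]
      have : S.n - (a + b) - J + j =
          (S.n - (a + b) - J + j - (S.n - (c + e) + 1)) + (S.n - (c + e) + 1) := by omega
      rw [this, pow_add, Module.End.mul_apply, hcp'.2, map_zero]
    · rw [S.proj_of_mem_ne (S.lefschetz_pow_mem j hcp'.1) heq, map_zero]

/-- The Hodge map exists and is unique. -/
theorem existsUnique_hodge : ∃! f, S.IsHodge f := by
  let e := LinearEquiv.ofBijective S.assemble ⟨S.assemble_injective, S.assemble_surjective⟩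
  let Φ : (DirectSum ((ℕ × ℕ) × ℕ) fun p => S.piece p) →ₗ[ℂ] Ω :=
    DirectSum.toModule ℂ _ Ω fun p =>
      ((-1 : ℂ) ^ ((p.1.1 + p.1.2) * (p.1.1 + p.1.2 + 1) / 2) *
        Complex.I ^ ((p.1.1 : ℤ) - (p.1.2 : ℤ)) *
        ((p.2.factorial : ℂ) / ((S.n - p.2 - (p.1.1 + p.1.2)).factorial : ℂ))) •
      ((S.lefschetz ^ (S.n - p.2 - (p.1.1 + p.1.2))) ∘ₗ (S.piece p).subtype)
  have hlof : ∀ p (y : S.piece p),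
      e (DirectSum.lof ℂ _ (fun p => S.piece p) p y) = (S.lefschetz ^ p.2) (y : Ω) :=
    fun p y => DirectSum.toModule_lof (M := fun p => S.piece p) ℂ p y
  refine ⟨Φ ∘ₗ e.symm.toLinearMap, ?_, ?_⟩
  · intro a b j h ω hω
    have hm : ω ∈ S.piece ((a, b), j) := by simpa [piece, h] using hω
    rw [← hlof ((a, b), j) ⟨ω, hm⟩]
    simp only [LinearMap.comp_apply, LinearEquiv.coe_coe, LinearEquiv.symm_apply_apply]
    exact DirectSum.toModule_lof (M := fun p => S.piece p) ℂ ((a, b), j) (⟨ω, hm⟩ : S.piece ((a, b), j))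
  · intro f hf
    rw [LinearEquiv.eq_comp_toLinearMap_symm]
    refine DirectSum.linearMap_ext ℂ fun p => LinearMap.ext fun y => ?_
    simp only [LinearMap.comp_apply, LinearEquiv.coe_coe]
    rw [hlof, DirectSum.toModule_lof]
    have hy := y.2
    by_cases h : p.1.1 + p.1.2 + p.2 ≤ S.n
    · simp only [piece, if_pos h] at hy
      exact hf _ _ _ h _ hy
    · simp only [piece, if_neg h, Submodule.mem_bot] at hy
      have hy0 : y = 0 := Subtype.ext hy
      rw [hy0]
      simp

/-- The Hodge map `∗_σ`. -/
def hodge : Ω →ₗ[ℂ] Ω := S.existsUnique_hodge.choose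

theorem isHodge_hodge : S.IsHodge S.hodge := S.existsUnique_hodge.choose_spec.1

/-- The metric `g_σ`: it vanishes on `Ω^k × Ω^l` for `k ≠ l` and equals `∗(ω ∧ ∗(ν^*))` on
`Ω^k × Ω^k`. -/
def metric : Ω →ₗ[ℂ] Ω →ₗ⋆[ℂ] B :=
  LinearMap.mk₂'ₛₗ (RingHom.id ℂ) (starRingEnd ℂ)
    (fun ω ν => ∑ k ∈ Finset.range (2 * S.n + 1),
      C.toBase (S.hodge (GradedAlgebra.proj C.deg k ω *
        S.hodge (C.conj (GradedAlgebra.proj C.deg k ν)))))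
    (fun ω ω' ν => by simp only [map_add, add_mul, Finset.sum_add_distrib])
    (fun r ω ν => by simp only [map_smul, smul_mul_assoc, Finset.smul_sum, RingHom.id_apply])
    (fun ω ν ν' => by simp only [map_add, mul_add, Finset.sum_add_distrib])
    (fun r ω ν => by
      simp only [map_smul, map_smulₛₗ, mul_smul_comm, Finset.smul_sum])

/-- Positivity of the metric: `g_σ(ω, ω)` is a non-zero element of the cone of finite sums of
elements `b* b`, for each non-zero form `ω`. -/
def Positive : Prop :=
  ∀ ω, ω ≠ 0 → S.metric ω ω ≠ 0 ∧
    ∃ (l : ℕ) (b : Fin l → B), S.metric ω ω = ∑ i, star (b i) * b i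

end HermitianStructure

end Calculus

/-! ### Compact quantum homogeneous Hermitian spaces -/

section Space

/-- A compact quantum homogeneous Hermitian space: a homogeneous space `B = A^{co(H)}` of compact
quantum group algebras, with a left `A`-covariant differential `*`-calculus `Ω` over `B`, and a
covariant, positive Hermitian structure with closed integral for it. -/
structure HermitianSpace (A H Ω : Type*)
    [Ring A] [HopfAlgebra ℂ A] [StarRing A] [StarModule ℂ A] [CQGA A]
    [Ring H] [HopfAlgebra ℂ H] [StarRing H] [StarModule ℂ H] [CQGA H]
    [Ring Ω] [Algebra ℂ Ω] where
  base : HomogeneousSpace A H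
  calculus : DiffStarCalculus base.coinv Ω
  /-- the left `A`-comodule algebra structure of the calculus -/
  coact : Ω →ₐ[ℂ] A ⊗[ℂ] Ω
  coact_coassoc : ∀ ω,
    TensorProduct.assoc ℂ A A Ω ((Coalgebra.comul (R := ℂ) (A := A)).rTensor Ω (coact ω)) =
      coact.toLinearMap.lTensor A (coact ω)
  coact_counit : ∀ ω,
    TensorProduct.lid ℂ Ω ((Coalgebra.counit (R := ℂ) (A := A)).rTensor Ω (coact ω)) = ω
  /-- the coaction extends the restriction `B → A ⊗ B` of the coproduct of `A` -/
  coact_incl : ∀ b : base.coinv, ∃ x : A ⊗[ℂ] base.coinv,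
    (base.coinv.subtype : base.coinv →ₗ[ℂ] A).lTensor A x = Coalgebra.comul (b : A) ∧
      coact (calculus.incl b) = calculus.incl.toLinearMap.lTensor A x
  coact_d : ∀ ω, coact (calculus.d ω) = calculus.d.lTensor A (coact ω)
  /-- the calculus is finitely generated as a left `B`-module -/
  finite : ∃ s : Finset Ω, ∀ ω, ∃ c : Ω → base.coinv, ω = ∑ x ∈ s, calculus.incl (c x) * x
  /-- `Ω B⁺ = B⁺ Ω`, for `B⁺` the kernel of the restriction to `B` of the counit of `A` -/
  mul_augmentation :
    Submodule.span ℂ {x : Ω | ∃ (ω : Ω) (b : base.coinv),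
        Coalgebra.counit (R := ℂ) (b : A) = 0 ∧ x = ω * calculus.incl b} =
      Submodule.span ℂ {x : Ω | ∃ (b : base.coinv) (ω : Ω),
        Coalgebra.counit (R := ℂ) (b : A) = 0 ∧ x = calculus.incl b * ω}
  herm : HermitianStructure calculus
  coact_bideg : ∀ p, ∀ ω ∈ herm.bideg p,
    coact ω ∈ LinearMap.range ((herm.bideg p).subtype.lTensor A)
  coact_σ : coact herm.σ = 1 ⊗ₜ herm.σ
  positive : herm.Positive
  /-- the integral, which is the composition of the Hodge map and the Haar functional, is closed -/
  integral_closed : ∀ k, k + 1 = 2 * herm.n → ∀ ω ∈ calculus.deg k,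
    haar A (calculus.toBase (herm.hodge (calculus.d ω)) : base.coinv) = 0

namespace HermitianSpace

variable {A H Ω : Type*}
  [Ring A] [HopfAlgebra ℂ A] [StarRing A] [StarModule ℂ A] [CQGA A]
  [Ring H] [HopfAlgebra ℂ H] [StarRing H] [StarModule ℂ H] [CQGA H]
  [Ring Ω] [Algebra ℂ Ω] (X : HermitianSpace A H Ω)

/-- The quantum homogeneous space `B`. -/
abbrev B : StarSubalgebra ℂ A := X.base.coinv

/-- The inner product `⟨ω, ν⟩ = h (g_σ(ω, ν))` of forms. -/
def innerForm : PosForm Ω where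
  form := LinearMap.mk₂'ₛₗ (RingHom.id ℂ) (starRingEnd ℂ)
    (fun ω ν => haar A (X.herm.metric ω ν : X.B))
    (fun ω ω' ν => by simp)
    (fun r ω ν => by simp)
    (fun ω ν ν' => by simp)
    (fun r ω ν => by simp)
  pos ω hω := by
    obtain ⟨hne, l, b, hb⟩ := X.positive ω hω
    have hval : ((X.herm.metric ω ω : X.B) : A) = ∑ i, star (b i : A) * (b i : A) := by
      rw [hb]
      simp
    change 0 < haar A (X.herm.metric ω ω : X.B)
    have hnn : ∀ i, 0 ≤ haar A (star (b i : A) * (b i : A)) := fun i => by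
      by_cases h : (b i : A) = 0
      · simp [h]
      · exact (haar_pos A h).le
    rw [hval, map_sum]
    refine Finset.sum_pos' (fun i _ => hnn i) ?_
    by_contra hcon
    push Not at hcon
    refine hne ?_
    rw [hb]
    refine Finset.sum_eq_zero fun i hi => ?_
    have : (b i : A) = 0 := by
      by_contra h
      exact hcon i hi (haar_pos A h)
    have hb0 : b i = 0 := Subtype.ext this
    simp [hb0]

/-- The Hilbert space `L²(Ω)` of square integrable forms. -/
abbrev L2 : Type _ := X.innerForm.Hilbert

/-- The canonical map of the forms into `L²(Ω)`. -/
abbrev toL2 : Ω →ₗ[ℂ] X.L2 := X.innerForm.toHilbert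

/-- Right multiplication `R_ω : ν ↦ ν ∧ ω`. -/
def rightMul (_ : HermitianSpace A H Ω) (ω : Ω) : Ω →ₗ[ℂ] Ω := LinearMap.mulRight ℂ ω

/-- The commutator `[T, R_b]` on `Ω`, for `b ∈ B`. -/
def commutator (T : Ω →ₗ[ℂ] Ω) (b : X.B) : Ω →ₗ[ℂ] Ω :=
  T ∘ₗ X.rightMul (X.calculus.incl b) - X.rightMul (X.calculus.incl b) ∘ₗ T

/-- The Dirac operator `T + T†` of an adjointable operator `T` on `Ω`. -/
def dirac (T : Ω →ₗ[ℂ] Ω) : Ω →ₗ[ℂ] Ω := T + X.innerForm.adjoint T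

end HermitianSpace

end Space

end CQH

end

/-!
Write `ε` for the counit of `A`. Right multiplication on the forms is compared with right
multiplication on finitely many copies of `A`.

The Hodge map commutes with every operator that preserves bidegrees and commutes with the Lefschetz
operator (`hodge_comm`). Applied to the operators `(φ ⊗ id) ∘ coact`, for functionals `φ` on `A`,
this shows that the Hodge map is covariant; the conjugation is covariant because the calculus is
generated in degree zero (`coact_conj`). The metric can be written `g(ω, ν) = vol (ω ∧ ∗(ν^*))` for
all forms (`metric_eq`), where `vol` extracts the coefficient of top degree. By covariance it is
determined by the positive semidefinite form `q(ω, ν) = ε(g(ω, ν))` on `Ω`. Since the Hodge map and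
the conjugation are bijective, the radical of `q` consists of the `ω` with `ε(vol (ω ∧ ν)) = 0` for
all `ν`, so it is a right ideal (`mul_mem_ker_fibreForm`). It contains `B⁺Ω = ΩB⁺`, so it has finite
codimension, and `B` acts from the right on the quotient through `ε`. The coordinates of a form with
respect to an orthonormal basis modulo the radical, combined with the coaction, give maps
`Fᵢ : Ω → A` with `g(ω, ν) = ∑ Fᵢ(ω) Fᵢ(ν)*`, for which right multiplication by a form `η` is
multiplication by a matrix with entries in `A`, equal to the scalar matrix `b` if `η = b ∈ B`
(`exists_coordinates`).

Right multiplication by an element of `A` is bounded on `L²(A)`, because the element is a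
combination of matrix coefficients of a unitary corepresentation (`bounded_mulRight`). With the
coordinates `Fᵢ`, this gives the boundedness of all `R_η` and the bound `‖ρ(b)‖ ≤ ‖b‖_red`.

If `T` is one of `d`, `∂`, `∂̄`, then `T` satisfies the graded Leibniz rule and has closed integral,
so that `-∗T∗`, up to conjugation, is a formal adjoint of it (`integral_metric_codiff`). The Leibniz
rule gives `[T, R_b] = R_{Tb} ∘ γ`, with `γ` the grading automorphism, which is isometric. The
commutator with the adjoint of `T` is minus the adjoint of `[T, R_{b*}]`.
-/

noncomputable section

namespace CQH

open scoped TensorProduct ComplexOrder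

/-! ### Bounded and adjointable operators for a positive form -/

namespace PosForm

variable {E : Type*} [AddCommGroup E] [Module ℂ E] (F : PosForm E)

theorem norm_toHilbert_sq (x : E) : ‖F.toHilbert x‖ ^ 2 = (F.form x x).re := by
  rw [← F.inner_toHilbert x x, inner_self_eq_norm_sq_to_K]
  norm_cast

theorem form_self (x : E) : F.form x x = ((‖F.toHilbert x‖ ^ 2 : ℝ) : ℂ) := by
  rw [← F.inner_toHilbert x x, inner_self_eq_norm_sq_to_K]
  norm_cast

theorem norm_form_le (x y : E) : ‖F.form x y‖ ≤ ‖F.toHilbert x‖ * ‖F.toHilbert y‖ := by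
  rw [← F.inner_toHilbert x y, mul_comm]
  exact norm_inner_le_norm _ _

theorem toHilbert_injective : Function.Injective F.toHilbert := by
  refine (injective_iff_map_eq_zero _).2 fun x hx => ?_
  by_contra hne
  have := F.pos x hne
  rw [F.form_self, hx] at this
  simp at this

variable {F}

theorem Bounded.exists_nonneg {T : E →ₗ[ℂ] E} (hT : F.Bounded T) :
    ∃ C : ℝ, 0 ≤ C ∧ ∀ x, ‖F.toHilbert (T x)‖ ≤ C * ‖F.toHilbert x‖ := by
  obtain ⟨C, hC⟩ := hT
  exact ⟨max C 0, le_max_right _ _, fun x =>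
    (hC x).trans (mul_le_mul_of_nonneg_right (le_max_left _ _) (norm_nonneg _))⟩

theorem Bounded.comp {T S : E →ₗ[ℂ] E} (hT : F.Bounded T) (hS : F.Bounded S) :
    F.Bounded (T ∘ₗ S) := by
  obtain ⟨C, hC0, hC⟩ := hT.exists_nonneg
  obtain ⟨D, hD⟩ := hS
  refine ⟨C * D, fun x => (hC (S x)).trans ?_⟩
  rw [mul_assoc]
  exact mul_le_mul_of_nonneg_left (hD x) hC0

theorem Bounded.add {T S : E →ₗ[ℂ] E} (hT : F.Bounded T) (hS : F.Bounded S) :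
    F.Bounded (T + S) := by
  obtain ⟨C, hC⟩ := hT
  obtain ⟨D, hD⟩ := hS
  refine ⟨C + D, fun x => ?_⟩
  rw [LinearMap.add_apply, map_add, add_mul]
  exact (norm_add_le _ _).trans (add_le_add (hC x) (hD x))

theorem Bounded.smul {T : E →ₗ[ℂ] E} (hT : F.Bounded T) (c : ℂ) : F.Bounded (c • T) := by
  obtain ⟨C, hC⟩ := hT
  refine ⟨‖c‖ * C, fun x => ?_⟩
  rw [LinearMap.smul_apply, map_smul, norm_smul, mul_assoc]
  exact mul_le_mul_of_nonneg_left (hC x) (norm_nonneg _)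

theorem Bounded.neg {T : E →ₗ[ℂ] E} (hT : F.Bounded T) : F.Bounded (-T) := by
  simpa using hT.smul (-1)

theorem bounded_zero : F.Bounded (0 : E →ₗ[ℂ] E) := ⟨0, fun x => by simp⟩

theorem IsAdjoint.symm {T S : E →ₗ[ℂ] E} (h : F.IsAdjoint T S) : F.IsAdjoint S T := fun x y => by
  rw [← F.conj_symm, ← h, F.conj_symm]

/-- An operator that is adjoint on `E` to a bounded operator is bounded. -/
theorem Bounded.of_isAdjoint {T S : E →ₗ[ℂ] E} (hT : F.Bounded T) (h : F.IsAdjoint T S) :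
    F.Bounded S := by
  obtain ⟨C, hC0, hC⟩ := hT.exists_nonneg
  refine ⟨C, fun x => ?_⟩
  rcases (norm_nonneg (F.toHilbert (S x))).eq_or_lt with h0 | h0
  · rw [← h0]; positivity
  refine le_of_mul_le_mul_left ?_ h0
  calc ‖F.toHilbert (S x)‖ * ‖F.toHilbert (S x)‖ = ‖F.form (S x) (S x)‖ := by
        rw [F.form_self, Complex.norm_real, Real.norm_of_nonneg (by positivity), sq]
    _ = ‖F.form (T (S x)) x‖ := by rw [h]
    _ ≤ ‖F.toHilbert (T (S x))‖ * ‖F.toHilbert x‖ := F.norm_form_le _ _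
    _ ≤ (C * ‖F.toHilbert (S x)‖) * ‖F.toHilbert x‖ :=
        mul_le_mul_of_nonneg_right (hC _) (norm_nonneg _)
    _ = ‖F.toHilbert (S x)‖ * (C * ‖F.toHilbert x‖) := by ring

theorem norm_extend_le {T : E →ₗ[ℂ] E} {C : ℝ} (hC : 0 ≤ C)
    (hT : ∀ x, ‖F.toHilbert (T x)‖ ≤ C * ‖F.toHilbert x‖) : ‖F.extend T‖ ≤ C := by
  refine ContinuousLinearMap.opNorm_le_bound _ hC fun x => ?_
  induction x using F.denseRange_toHilbert.induction_on with
  | hp => exact isClosed_le (by fun_prop) (by fun_prop)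
  | ih x => rw [F.extend_toHilbert ⟨C, hT⟩]; exact hT x

theorem norm_toHilbert_le_extend {T : E →ₗ[ℂ] E} (hT : F.Bounded T) (x : E) :
    ‖F.toHilbert (T x)‖ ≤ ‖F.extend T‖ * ‖F.toHilbert x‖ := by
  rw [← F.extend_toHilbert hT]
  exact ContinuousLinearMap.le_opNorm _ _

theorem clm_ext {T S : F.Hilbert →L[ℂ] F.Hilbert}
    (h : ∀ x, T (F.toHilbert x) = S (F.toHilbert x)) : T = S := by
  refine ContinuousLinearMap.coeFn_injective
    (F.denseRange_toHilbert.equalizer T.continuous S.continuous (funext h))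

theorem extend_adjoint {T S : E →ₗ[ℂ] E} (hT : F.Bounded T) (h : F.IsAdjoint T S) :
    F.extend S = ContinuousLinearMap.adjoint (F.extend T) := by
  refine clm_ext fun x => ?_
  refine F.denseRange_toHilbert.eq_of_inner_right ℂ ?_
  intro y
  rw [ContinuousLinearMap.adjoint_inner_right, F.extend_toHilbert hT,
    F.extend_toHilbert (hT.of_isAdjoint h), F.inner_toHilbert, F.inner_toHilbert, h.symm]

end PosForm

/-! ### Orthonormal families for positive semidefinite forms -/

section Semidefinite

variable {E : Type*} [AddCommGroup E] [Module ℂ E] {p : E →ₗ[ℂ] E →ₗ⋆[ℂ] ℂ}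

theorem conj_symm_of_nonneg (hp : ∀ x, 0 ≤ p x x) (x y : E) :
    (starRingEnd ℂ) (p y x) = p x y := by
  have im0 : ∀ z, (p z z).im = 0 := fun z => (Complex.le_def.1 (hp z)).2.symm
  have h1 := im0 (x + y)
  have h2 := im0 (x + Complex.I • y)
  simp only [map_add, LinearMap.add_apply, map_smul, map_smulₛₗ, LinearMap.smul_apply, smul_eq_mul,
    Complex.add_im, Complex.add_re, im0, Complex.mul_im, Complex.mul_re, Complex.I_re,
    Complex.I_im, Complex.conj_I, Complex.neg_re, Complex.neg_im] at h1 h2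
  apply Complex.ext
  · simp only [Complex.conj_re]; linarith
  · simp only [Complex.conj_im]; linarith

/-- By the Cauchy–Schwarz inequality, isotropic vectors lie in the radical. -/
theorem mem_ker_of_self_eq_zero (hp : ∀ x, 0 ≤ p x x) {x : E} (hx : p x x = 0) :
    x ∈ LinearMap.ker p := by
  let c : PreInnerProductSpace.Core ℂ E :=
    { inner := fun x y => p y x
      conj_inner_symm := fun x y => conj_symm_of_nonneg hp _ _
      re_inner_nonneg := fun x => (Complex.le_def.1 (hp x)).1
      add_left := fun x y z => map_add (p z) x y
      smul_left := fun x y r => map_smulₛₗ (p y) r x }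
  refine LinearMap.mem_ker.2 (LinearMap.ext fun y => ?_)
  have h : ‖p y x‖ * ‖p x y‖ ≤ (p x x).re * (p y y).re :=
    @InnerProductSpace.Core.inner_mul_inner_self_le ℂ E _ _ _ c x y
  rw [← conj_symm_of_nonneg hp y x, RCLike.norm_conj, hx, Complex.zero_re, zero_mul] at h
  simpa using mul_self_eq_zero.1 (le_antisymm h (mul_self_nonneg _))

/-- A positive semidefinite form whose radical has finite codimension admits a finite orthonormal
family that spans modulo the radical. -/
theorem exists_orthonormal_modulo_ker (hp : ∀ x, 0 ≤ p x x) (s : Finset E)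
    (hs : LinearMap.ker p ⊔ Submodule.span ℂ (s : Set E) = ⊤) :
    ∃ (r : ℕ) (v : Fin r → E), (∀ i j, p (v i) (v j) = if i = j then 1 else 0) ∧
      ∀ x, x - ∑ i, p x (v i) • v i ∈ LinearMap.ker p := by
  obtain ⟨W, hW⟩ := Submodule.exists_isCompl (LinearMap.ker p)
  have : Module.Finite ℂ (E ⧸ LinearMap.ker p) := by
    refine Module.Finite.of_surjective
      ((LinearMap.ker p).mkQ ∘ₗ (Submodule.span ℂ (s : Set E)).subtype) fun y => ?_
    obtain ⟨x, rfl⟩ := (LinearMap.ker p).mkQ_surjective y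
    obtain ⟨k, hk, z, hz, rfl⟩ := Submodule.mem_sup.1 (hs ▸ Submodule.mem_top : x ∈ _)
    refine ⟨⟨z, hz⟩, ?_⟩
    simp [(Submodule.Quotient.mk_eq_zero _).2 hk]
  have hfin : Module.Finite ℂ W :=
    Module.Finite.equiv (Submodule.quotientEquivOfIsCompl _ W hW)
  let G : PosForm W :=
    { form := (p.domRestrict₁₂ W W)
      pos := fun x hx => lt_of_le_of_ne (hp x) fun h0 => hx (Subtype.ext (by
        simpa using hW.disjoint.le_bot ⟨mem_ker_of_self_eq_zero hp h0.symm, x.2⟩)) }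
  have : FiniteDimensional ℂ G.Space := hfin
  let e := stdOrthonormalBasis ℂ G.Space
  let v : Fin (Module.finrank ℂ G.Space) → W := e
  refine ⟨_, fun i => (v i : E), fun i j => ?_, fun x => ?_⟩
  · have := orthonormal_iff_ite.1 e.orthonormal j i
    simp only [eq_comm (a := j)] at this
    exact this
  · obtain ⟨k, hk, w, hw, rfl⟩ := Submodule.mem_sup.1
      (hW.sup_eq_top ▸ Submodule.mem_top : x ∈ LinearMap.ker p ⊔ W)
    have hk0 : p k = 0 := hk
    have hsum : (⟨w, hw⟩ : W) = ∑ i, p w (v i) • v i := (e.sum_repr' (⟨w, hw⟩ : W)).symm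
    have hsum' : w = ∑ i, p w (v i) • (v i : E) := by
      have := congrArg Subtype.val hsum
      simpa using this
    rw [map_add, hk0, zero_add, ← hsum', add_sub_cancel_right]
    exact hk

end Semidefinite

/-! ### Slices of tensors -/

section Slice

variable {A M N : Type*} [AddCommGroup A] [Module ℂ A] [AddCommGroup M] [Module ℂ M]
  [AddCommGroup N] [Module ℂ N]

/-- The slice map `φ ⊗ id` on `A ⊗ M`. -/
def sliceLeft (φ : A →ₗ[ℂ] ℂ) : A ⊗[ℂ] M →ₗ[ℂ] M :=
  (TensorProduct.lid ℂ M).toLinearMap ∘ₗ φ.rTensor M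

/-- The slice map `id ⊗ f` on `A ⊗ M`. -/
def sliceRight (f : M →ₗ[ℂ] ℂ) : A ⊗[ℂ] M →ₗ[ℂ] A :=
  (TensorProduct.rid ℂ A).toLinearMap ∘ₗ f.lTensor A

@[simp] theorem sliceLeft_tmul (φ : A →ₗ[ℂ] ℂ) (a : A) (m : M) :
    sliceLeft φ (a ⊗ₜ[ℂ] m) = φ a • m := by simp [sliceLeft]

@[simp] theorem sliceRight_tmul (f : M →ₗ[ℂ] ℂ) (a : A) (m : M) :
    sliceRight f (a ⊗ₜ[ℂ] m) = f m • a := by simp [sliceRight]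

theorem sliceLeft_lTensor (φ : A →ₗ[ℂ] ℂ) (g : M →ₗ[ℂ] N) (t : A ⊗[ℂ] M) :
    sliceLeft φ (g.lTensor A t) = g (sliceLeft φ t) := by
  induction t with
  | zero => simp
  | tmul a m => simp
  | add x y hx hy => simp only [map_add, hx, hy]

theorem sliceRight_lTensor (f : N →ₗ[ℂ] ℂ) (g : M →ₗ[ℂ] N) (t : A ⊗[ℂ] M) :
    sliceRight f (g.lTensor A t) = sliceRight (f ∘ₗ g) t := by
  simp [sliceRight, LinearMap.lTensor_comp]

theorem sliceLeft_mem (φ : A →ₗ[ℂ] ℂ) (W : Submodule ℂ M) {t : A ⊗[ℂ] M}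
    (ht : t ∈ LinearMap.range (W.subtype.lTensor A)) : sliceLeft φ t ∈ W := by
  obtain ⟨t, rfl⟩ := ht
  rw [sliceLeft_lTensor]
  exact Subtype.mem _

/-- Slices separate the points of a tensor product of vector spaces. -/
theorem eq_of_sliceLeft_eq {t t' : A ⊗[ℂ] M}
    (h : ∀ φ : A →ₗ[ℂ] ℂ, sliceLeft φ t = sliceLeft φ t') : t = t' := by
  classical
  refine (TensorProduct.equivFinsuppOfBasisLeft (N := M)
    (Module.Basis.ofVectorSpace ℂ A)).injective (Finsupp.ext fun i => ?_)
  rw [TensorProduct.equivFinsuppOfBasisLeft_apply, TensorProduct.equivFinsuppOfBasisLeft_apply]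
  exact h _

end Slice

/-! ### Right multiplication on a compact quantum group algebra -/

section Reduced

variable {A : Type*} [Ring A] [HopfAlgebra ℂ A]

/-- Every element of a Hopf algebra lies in a finite dimensional left subcomodule. -/
theorem exists_finite_subcomodule (a : A) : ∃ s : Finset A, a ∈ Submodule.span ℂ (s : Set A) ∧
    ∀ x ∈ Submodule.span ℂ (s : Set A), Coalgebra.comul (R := ℂ) x ∈
      LinearMap.range ((Submodule.span ℂ (s : Set A)).subtype.lTensor A) := by
  classical
  let e := Module.Basis.ofVectorSpace ℂ A
  -- The subcomodule is spanned by the slices `y i` of the coproduct of `a` along a basis of `A`.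
  let y := TensorProduct.equivFinsuppOfBasisLeft (N := A) e (Coalgebra.comul (R := ℂ) a)
  have hy : ∀ i, y i = sliceLeft (e.coord i) (Coalgebra.comul (R := ℂ) a) := fun i =>
    TensorProduct.equivFinsuppOfBasisLeft_apply e _ i
  have hsum : Coalgebra.comul (R := ℂ) a = ∑ i ∈ y.support, e i ⊗ₜ[ℂ] y i := by
    rw [← (TensorProduct.equivFinsuppOfBasisLeft (N := A) e).symm_apply_apply
      (Coalgebra.comul (R := ℂ) a), TensorProduct.equivFinsuppOfBasisLeft_symm_apply]
    rfl
  have hmem : ∀ i ∈ y.support, y i ∈ Submodule.span ℂ ((y.support.image y : Finset A) : Set A) :=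
    fun i hi => Submodule.subset_span (Finset.mem_coe.2 (Finset.mem_image_of_mem _ hi))
  have hslice : ∀ (φ : A →ₗ[ℂ] ℂ) (t : A ⊗[ℂ] A) (z : A),
      sliceLeft φ (TensorProduct.assoc ℂ A A A (t ⊗ₜ[ℂ] z)) = sliceLeft φ t ⊗ₜ[ℂ] z := by
    intro φ t z
    induction t with
    | zero => simp
    | tmul a b => simp [TensorProduct.smul_tmul']
    | add t t' h h' => simp only [map_add, TensorProduct.add_tmul, h, h']
  refine ⟨y.support.image y, ?_, fun x hx => ?_⟩
  · have h := congrArg (TensorProduct.lid ℂ A) (Coalgebra.rTensor_counit_comul (R := ℂ) a)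
    rw [hsum] at h
    simp only [map_sum, LinearMap.rTensor_tmul, TensorProduct.lid_tmul, one_smul] at h
    rw [← h]
    exact Submodule.sum_mem _ fun i hi => Submodule.smul_mem _ _ (hmem i hi)
  · induction hx using Submodule.span_induction with
    | zero => rw [map_zero]; exact Submodule.zero_mem _
    | add x x' _ _ h h' => rw [map_add]; exact Submodule.add_mem _ h h'
    | smul c x _ h => rw [map_smul]; exact Submodule.smul_mem _ _ h
    | mem x hx =>
      obtain ⟨j, -, rfl⟩ := Finset.mem_image.1 (Finset.mem_coe.1 hx)
      rw [hy, ← sliceLeft_lTensor, ← Coalgebra.coassoc_apply, hsum]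
      simp only [map_sum, LinearMap.rTensor_tmul, hslice]
      exact Submodule.sum_mem _ fun i hi => ⟨_ ⊗ₜ[ℂ] ⟨y i, hmem i hi⟩, rfl⟩

variable [StarRing A] [StarModule ℂ A] [CQGA A]

theorem haar_mul_star_nonneg (a : A) : 0 ≤ haar A (a * star a) := (haarForm A).nonneg a

/-- If `∑ uᵢ uᵢ* = 1`, then right multiplication by each `uᵢ` is a contraction of `L²(A)`. -/
theorem bounded_mulRight_of_sum_mul_star {ι : Type*} [Fintype ι] {u : ι → A}
    (hu : ∑ i, u i * star (u i) = 1) (i : ι) :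
    (haarForm A).Bounded (LinearMap.mulRight ℂ (u i)) := by
  refine ⟨1, fun x => ?_⟩
  rw [one_mul, ← sq_le_sq₀ (norm_nonneg _) (norm_nonneg _), (haarForm A).norm_toHilbert_sq, (haarForm A).norm_toHilbert_sq]
  have key : ∑ i, haar A ((x * u i) * star (x * u i)) = haar A (x * star x) := by
    rw [← map_sum]
    congr 1
    calc ∑ i, x * u i * star (x * u i) = x * (∑ i, u i * star (u i)) * star x := by
          rw [Finset.mul_sum, Finset.sum_mul]
          exact Finset.sum_congr rfl fun i _ => by rw [star_mul]; noncomm_ring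
      _ = x * star x := by rw [hu, mul_one]
  refine (Complex.le_def.1 ?_).1
  change haar A ((x * u i) * star (x * u i)) ≤ haar A (x * star x)
  rw [← key]
  exact Finset.single_le_sum (f := fun i => haar A ((x * u i) * star (x * u i)))
    (fun i _ => haar_mul_star_nonneg _) (Finset.mem_univ i)

/-- Right multiplication by any element of a compact quantum group algebra is bounded: the element
is a linear combination of matrix coefficients of a unitary corepresentation, the invariant inner
product on a finite dimensional subcomodule being provided by the Haar functional. -/
theorem bounded_mulRight (a : A) : (haarForm A).Bounded (LinearMap.mulRight ℂ a) := by
  obtain ⟨s, has, hs⟩ := exists_finite_subcomodule a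
  set W := Submodule.span ℂ (s : Set A) with hW
  let p : W →ₗ[ℂ] W →ₗ⋆[ℂ] ℂ := (haarForm A).form.domRestrict₁₂ W W
  have hp : ∀ x, 0 ≤ p x x := fun x => (haarForm A).nonneg _
  have hker : LinearMap.ker p = ⊥ := by
    refine (Submodule.eq_bot_iff _).2 fun x hx => ?_
    by_contra hne
    have h0 : p x x = 0 := by rw [LinearMap.mem_ker.1 hx]; rfl
    exact ((haarForm A).pos (x : A) fun h => hne (Subtype.ext h)).ne' h0
  have hfin : Module.Finite ℂ W := Module.Finite.iff_fg.2 ⟨s, rfl⟩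
  obtain ⟨t, ht⟩ := hfin.fg_top
  obtain ⟨r, v, hv, hexp⟩ := exists_orthonormal_modulo_ker hp t (by rw [ht]; exact sup_top_eq _)
  have hexp : ∀ x : W, x = ∑ i, p x (v i) • v i := fun x => by
    have := hexp x
    rwa [hker, Submodule.mem_bot, sub_eq_zero] at this
  let f : Fin r → A →ₗ[ℂ] ℂ := fun i =>
    { toFun := fun x => haar A (x * star (v i : A))
      map_add' := fun x y => by rw [add_mul, map_add]
      map_smul' := fun c x => by rw [smul_mul_assoc, map_smul]; rfl }
  let u : Fin r → Fin r → A := fun i j => sliceRight (f j) (Coalgebra.comul (R := ℂ) (v i : A))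
  have hcomul : ∀ i, Coalgebra.comul (R := ℂ) (v i : A) = ∑ j, u i j ⊗ₜ[ℂ] (v j : A) := by
    intro i
    obtain ⟨z, hz⟩ := hs _ (v i).2
    simp only [u, ← hz]
    clear hz
    induction z with
    | zero => simp
    | tmul b w =>
      have hw : (w : A) = ∑ j, f j (w : A) • (v j : A) := by
        have := congrArg Subtype.val (hexp w)
        rw [Submodule.coe_sum] at this
        exact this
      simp only [LinearMap.lTensor_tmul, Submodule.subtype_apply, sliceRight_tmul]
      conv_lhs => rw [hw]
      rw [TensorProduct.tmul_sum]
      exact Finset.sum_congr rfl fun j _ => by rw [TensorProduct.tmul_smul, TensorProduct.smul_tmul']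
    | add z z' h h' =>
      rw [map_add]
      conv_lhs => rw [h, h']
      simp only [map_add, TensorProduct.add_tmul, Finset.sum_add_distrib]
  have hfv : ∀ i j, haar A ((v i : A) * star (v j : A)) = if i = j then 1 else 0 := hv
  -- The invariance of the Haar functional is the unitarity of the matrix `u`.
  have hunit : ∀ i, ∑ j, u i j * star (u i j) = 1 := by
    intro i
    have h := (isHaar_haar A).left_inv ((v i : A) * star (v i : A))
    rw [hfv, if_pos rfl, one_smul, Bialgebra.comul_mul, CQGA.comul_star, hcomul, star_sum,
      Finset.sum_mul_sum] at h
    rw [← h]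
    simp [hfv, TensorProduct.star_tmul]
  -- By the counit axiom, `v i` is a combination of the entries in row `i` of `u`.
  have hvu : ∀ i, (haarForm A).Bounded (LinearMap.mulRight ℂ (v i : A)) := by
    intro i
    have h := congrArg (TensorProduct.rid ℂ A) (Coalgebra.lTensor_counit_comul (R := ℂ) (v i : A))
    rw [hcomul] at h
    simp only [map_sum, LinearMap.lTensor_tmul, TensorProduct.rid_tmul, one_smul] at h
    rw [← h]
    have : LinearMap.mulRight ℂ (∑ j, Coalgebra.counit (R := ℂ) (v j : A) • u i j) =
        ∑ j, Coalgebra.counit (R := ℂ) (v j : A) • LinearMap.mulRight ℂ (u i j) := by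
      ext x; simp [Finset.mul_sum]
    rw [this]
    exact Finset.sum_induction _ _ (fun _ _ => PosForm.Bounded.add) PosForm.bounded_zero
      fun j _ => (bounded_mulRight_of_sum_mul_star (hunit i) j).smul _
  have ha : a = ∑ i, p ⟨a, has⟩ (v i) • (v i : A) := by
    have := congrArg Subtype.val (hexp ⟨a, has⟩)
    simpa using this
  have : LinearMap.mulRight ℂ a = ∑ i, p ⟨a, has⟩ (v i) • LinearMap.mulRight ℂ (v i : A) := by
    conv_lhs => rw [ha]
    ext x; simp [Finset.mul_sum]
  rw [this]
  exact Finset.sum_induction _ _ (fun _ _ => PosForm.Bounded.add) PosForm.bounded_zero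
    fun i _ => (hvu i).smul _

/-- The counit is a `*`-map, by the uniqueness of the counit. -/
theorem counit_star (a : A) :
    Coalgebra.counit (R := ℂ) (star a) = (starRingEnd ℂ) (Coalgebra.counit (R := ℂ) a) := by
  have key : ∀ t : A ⊗[ℂ] A,
      (starRingEnd ℂ) (Coalgebra.counit (R := ℂ) (star (TensorProduct.rid ℂ A
        ((Coalgebra.counit (R := ℂ) (A := A)).lTensor A t)))) =
      Coalgebra.counit (R := ℂ) (star (TensorProduct.lid ℂ A
        ((Coalgebra.counit (R := ℂ) (A := A)).rTensor A (star t)))) := by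
    intro t
    induction t with
    | zero => simp
    | tmul x y => simp [TensorProduct.star_tmul, mul_comm]
    | add x y hx hy => simp only [map_add, star_add, hx, hy]
  have h := key (Coalgebra.comul a)
  rw [← CQGA.comul_star, Coalgebra.lTensor_counit_comul, Coalgebra.rTensor_counit_comul] at h
  simp only [TensorProduct.rid_tmul, TensorProduct.lid_tmul, one_smul, star_star] at h
  rw [← h, Complex.conj_conj]

end Reduced

/-! ### The Hodge map -/

section Calculus

variable {B Ω : Type*} [Ring B] [Algebra ℂ B] [StarRing B] [Ring Ω] [Algebra ℂ Ω]

namespace DiffStarCalculus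

variable (C : DiffStarCalculus B Ω)

theorem incl_mem (b : B) : C.incl b ∈ C.deg 0 := by
  rw [← C.range_incl]
  exact ⟨b, rfl⟩

theorem proj_of_mem {k : ℕ} {ω : Ω} (h : ω ∈ C.deg k) : GradedAlgebra.proj C.deg k ω = ω := by
  rw [GradedAlgebra.proj_apply]; exact DirectSum.decompose_of_mem_same _ h

theorem proj_of_mem_ne {k l : ℕ} {ω : Ω} (h : ω ∈ C.deg k) (hne : k ≠ l) :
    GradedAlgebra.proj C.deg l ω = 0 := by
  rw [GradedAlgebra.proj_apply]; exact DirectSum.decompose_of_mem_ne _ h hne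

theorem toBase_of_mem_ne {k : ℕ} {ω : Ω} (h : ω ∈ C.deg k) (hk : k ≠ 0) : C.toBase ω = 0 :=
  C.incl_injective (by rw [C.incl_toBase, C.proj_of_mem_ne h hk, map_zero])

theorem toBase_incl (b : B) : C.toBase (C.incl b) = b :=
  C.incl_injective (by rw [C.incl_toBase, C.proj_of_mem (C.incl_mem b)])

theorem toBase_incl_mul (b : B) (ω : Ω) : C.toBase (C.incl b * ω) = b * C.toBase ω :=
  C.incl_injective (by
    rw [map_mul C.incl, C.incl_toBase, C.incl_toBase, GradedAlgebra.proj_apply, GradedAlgebra.proj_apply]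
    simpa using DirectSum.coe_decompose_mul_add_of_left_mem C.deg (j := 0) (b := ω) (C.incl_mem b))

theorem conj_mul_incl (ω : Ω) (b : B) :
    C.conj (ω * C.incl b) = C.incl (star b) * C.conj ω := by
  induction ω using DirectSum.Decomposition.inductionOn C.deg with
  | zero => simp
  | add x y hx hy => rw [add_mul, map_add, map_add, mul_add, hx, hy]
  | homogeneous x => rw [C.conj_mul _ 0 _ x.2 _ (C.incl_mem b), C.conj_incl]; simp

end DiffStarCalculus

namespace HermitianStructure

variable {C : DiffStarCalculus B Ω} (S : HermitianStructure C)

/-- By the Lefschetz decomposition, a linear map is determined by its values on the forms `L^j ω`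
with `ω` primitive. -/
theorem ext_lefschetz {M : Type*} [AddCommGroup M] [Module ℂ M] {f g : Ω →ₗ[ℂ] M}
    (h : ∀ a b j, a + b + j ≤ S.n → ∀ ω ∈ S.prim a b,
      f ((S.lefschetz ^ j) ω) = g ((S.lefschetz ^ j) ω)) : f = g := by
  have key : f ∘ₗ S.assemble = g ∘ₗ S.assemble := by
    refine DirectSum.linearMap_ext ℂ fun p => LinearMap.ext fun y => ?_
    have hy := y.2
    have e : S.assemble (DirectSum.lof ℂ _ (fun p => S.piece p) p y) =
        (S.lefschetz ^ p.2) (y : Ω) := DirectSum.toModule_lof (M := fun p => S.piece p) ℂ p y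
    simp only [LinearMap.comp_apply, e]
    by_cases hp : p.1.1 + p.1.2 + p.2 ≤ S.n
    · simp only [piece, if_pos hp] at hy
      exact h _ _ _ hp _ hy
    · simp only [piece, if_neg hp, Submodule.mem_bot] at hy
      rw [hy]
      simp
  refine LinearMap.ext fun x => ?_
  obtain ⟨y, rfl⟩ := S.assemble_surjective x
  exact LinearMap.congr_fun key y

theorem bideg_induction {P : Ω → Prop} (zero : P 0)
    (mem : ∀ a b, ∀ ω ∈ S.bideg (a, b), P ω) (add : ∀ x y, P x → P y → P (x + y)) (ω : Ω) :
    P ω :=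
  DirectSum.Decomposition.inductionOn S.bideg zero (fun {p} x => mem p.1 p.2 x x.2) add ω

theorem conj_mem_deg (S : HermitianStructure C) {k : ℕ} {ω : Ω} (h : ω ∈ C.deg k) : C.conj ω ∈ C.deg k := by
  have : C.deg k ≤ (C.deg k).comap C.conj := by
    conv_lhs => rw [S.deg_eq]
    refine iSup₂_le fun p hp ω hω => ?_
    have := S.bideg_le _ _ ((S.conj_mem p.1 p.2 ω).1 hω)
    rwa [add_comm, hp] at this
  exact this h

theorem incl_mem_bideg (b : B) : C.incl b ∈ S.bideg (0, 0) := by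
  have : C.deg 0 ≤ S.bideg (0, 0) := by
    rw [S.deg_eq]
    refine iSup₂_le fun p hp => ?_
    obtain rfl : p = (0, 0) := by ext <;> simp <;> omega
    exact le_rfl
  exact this (C.incl_mem b)

/-- An operator that preserves the bidegree and commutes with the Lefschetz operator commutes with
the Hodge map. -/
theorem hodge_comm {f : Ω →ₗ[ℂ] Ω} (hf : ∀ a b, ∀ ω ∈ S.bideg (a, b), f ω ∈ S.bideg (a, b))
    (hσ : ∀ ω, f (S.σ * ω) = S.σ * f ω) (ω : Ω) : S.hodge (f ω) = f (S.hodge ω) := by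
  have hL : ∀ j ω, f ((S.lefschetz ^ j) ω) = (S.lefschetz ^ j) (f ω) := by
    intro j
    induction j with
    | zero => simp
    | succ j ih =>
      intro ω
      rw [pow_succ, Module.End.mul_apply, ih, Module.End.mul_apply]
      exact congrArg _ (hσ ω)
  refine LinearMap.congr_fun (f := S.hodge ∘ₗ f) (g := f ∘ₗ S.hodge)
    (S.ext_lefschetz fun a b j h ω hω => ?_) ω
  have hfω : f ω ∈ S.prim a b := by
    have hm := S.mem_prim hω
    rw [prim, if_pos (by omega)]
    exact ⟨hf _ _ _ hm.1, by rw [SetLike.mem_coe, LinearMap.mem_ker, ← hL, hm.2, map_zero]⟩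
  simp only [LinearMap.comp_apply]
  rw [hL, S.isHodge_hodge a b j h _ hfω, S.isHodge_hodge a b j h _ hω, map_smul, hL]

theorem hodge_incl_mul (b : B) (ω : Ω) : S.hodge (C.incl b * ω) = C.incl b * S.hodge ω :=
  S.hodge_comm (f := LinearMap.mulLeft ℂ (C.incl b))
    (fun a c ω hω => by
      have := SetLike.mul_mem_graded (S.incl_mem_bideg b) hω
      simpa using this)
    (fun ω => by
      simp only [LinearMap.mulLeft_apply]
      rw [← mul_assoc, ← S.σ_central, mul_assoc]) ω

/-- The Hodge map takes the summand `L^j P^{(a,b)}` of the `(j + a, j + b)`-forms to forms of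
bidegree `(n - j - b, n - j - a)`. -/
theorem hodge_lefschetz_mem {a b j : ℕ} (h : a + b + j ≤ S.n) {ω : Ω} (hω : ω ∈ S.prim a b) :
    S.hodge ((S.lefschetz ^ j) ω) ∈ S.bideg (S.n - j - b, S.n - j - a) := by
  rw [S.isHodge_hodge a b j h ω hω]
  refine Submodule.smul_mem _ _ ?_
  have := S.lefschetz_pow_mem (S.n - j - (a + b)) (S.mem_prim hω).1
  convert this using 3 <;> omega

/-! ### The grading automorphism and the square of the Hodge map -/

/-- The grading automorphism, which is `(-1)^k` on the forms of degree `k`. -/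
def grading : Ω →ₗ[ℂ] Ω := S.piecewise fun a b => (-1 : ℂ) ^ (a + b) • LinearMap.id

theorem grading_of_mem {a b : ℕ} {ω : Ω} (h : ω ∈ S.bideg (a, b)) :
    S.grading ω = (-1 : ℂ) ^ (a + b) • ω := S.piecewise_apply _ h

theorem grading_of_mem_deg {k : ℕ} {ω : Ω} (h : ω ∈ C.deg k) :
    S.grading ω = (-1 : ℂ) ^ k • ω := by
  have : C.deg k ≤ LinearMap.eqLocus S.grading ((-1 : ℂ) ^ k • LinearMap.id) := by
    rw [S.deg_eq]
    refine iSup₂_le fun p hp ω hω => ?_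
    rw [LinearMap.mem_eqLocus, S.grading_of_mem hω, hp]
    rfl
  exact this h

theorem grading_mul (ω ν : Ω) : S.grading (ω * ν) = S.grading ω * S.grading ν := by
  induction ω using DirectSum.Decomposition.inductionOn C.deg with
  | zero => simp
  | add x y hx hy => simp only [add_mul, map_add, hx, hy]
  | @homogeneous k x =>
    induction ν using DirectSum.Decomposition.inductionOn C.deg with
    | zero => simp
    | add x y hx hy => simp only [mul_add, map_add, hx, hy]
    | @homogeneous l y =>
      rw [S.grading_of_mem_deg x.2, S.grading_of_mem_deg y.2,
        S.grading_of_mem_deg (SetLike.mul_mem_graded x.2 y.2), smul_mul_smul_comm, pow_add]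

theorem grading_grading (ω : Ω) : S.grading (S.grading ω) = ω := by
  induction ω using DirectSum.Decomposition.inductionOn C.deg with
  | zero => simp
  | add x y hx hy => simp only [map_add, hx, hy]
  | @homogeneous k x =>
    rw [S.grading_of_mem_deg x.2, map_smul, S.grading_of_mem_deg x.2, smul_smul, ← mul_pow]
    simp

theorem grading_conj (ω : Ω) : S.grading (C.conj ω) = C.conj (S.grading ω) := by
  induction ω using DirectSum.Decomposition.inductionOn C.deg with
  | zero => simp
  | add x y hx hy => simp only [map_add, hx, hy]
  | @homogeneous k x =>
    rw [S.grading_of_mem_deg x.2, S.grading_of_mem_deg (S.conj_mem_deg x.2), map_smulₛₗ]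
    simp

theorem neg_one_pow_eq_of_even {k l : ℕ} (h : Even (k + l)) : (-1 : ℂ) ^ k = (-1) ^ l := by
  rw [neg_one_pow_congr]
  exact Nat.even_add.1 h

theorem grading_hodge (ω : Ω) : S.grading (S.hodge ω) = S.hodge (S.grading ω) := by
  refine LinearMap.congr_fun (f := S.grading ∘ₗ S.hodge) (g := S.hodge ∘ₗ S.grading)
    (S.ext_lefschetz fun a b j h ω hω => ?_) ω
  simp only [LinearMap.comp_apply]
  rw [S.grading_of_mem (S.hodge_lefschetz_mem h hω),
    S.grading_of_mem (S.lefschetz_pow_mem j (S.mem_prim hω).1), map_smul]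
  congr 1
  exact neg_one_pow_eq_of_even ⟨S.n, by omega⟩

/-- The square of the Hodge map is `(-1)^k` on forms of degree `k`. -/
theorem hodge_hodge (ω : Ω) : S.hodge (S.hodge ω) = S.grading ω := by
  refine LinearMap.congr_fun (f := S.hodge ∘ₗ S.hodge) (g := S.grading)
    (S.ext_lefschetz fun a b j h ω hω => ?_) ω
  simp only [LinearMap.comp_apply]
  rw [S.grading_of_mem (S.lefschetz_pow_mem j (S.mem_prim hω).1), S.isHodge_hodge a b j h ω hω,
    map_smul, S.isHodge_hodge a b _ (by omega) ω hω, smul_smul]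
  have hj : S.n - (S.n - j - (a + b)) - (a + b) = j := by omega
  rw [hj]
  congr 1
  have h1 : ((-1 : ℂ) ^ ((a + b) * (a + b + 1) / 2)) * (-1) ^ ((a + b) * (a + b + 1) / 2) = 1 := by
    rw [← mul_pow]; simp
  have h2 : Complex.I ^ ((a : ℤ) - b) * Complex.I ^ ((a : ℤ) - b) = (-1 : ℂ) ^ (a + b) := by
    rw [← mul_zpow, Complex.I_mul_I, zpow_sub₀ (by norm_num), zpow_natCast, zpow_natCast, pow_add,
      div_eq_mul_inv, ← inv_pow]
    norm_num
  have h3 : (j.factorial : ℂ) / ((S.n - j - (a + b)).factorial : ℂ) *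
      (((S.n - j - (a + b)).factorial : ℂ) / (j.factorial : ℂ)) = 1 := by
    have e1 : (j.factorial : ℂ) ≠ 0 := by exact_mod_cast j.factorial_ne_zero
    have e2 : ((S.n - j - (a + b)).factorial : ℂ) ≠ 0 := by
      exact_mod_cast (S.n - j - (a + b)).factorial_ne_zero
    field_simp
  have h4 : (-1 : ℂ) ^ (j + a + (j + b)) = (-1) ^ (a + b) :=
    neg_one_pow_eq_of_even ⟨j + a + b, by omega⟩
  rw [h4, ← h2]
  linear_combination (Complex.I ^ ((a : ℤ) - b)) ^ 2 * ((j.factorial : ℂ) /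
    ((S.n - j - (a + b)).factorial : ℂ)) * (((S.n - j - (a + b)).factorial : ℂ) /
    (j.factorial : ℂ)) * h1 + (Complex.I ^ ((a : ℤ) - b)) ^ 2 * h3

theorem hodge_mem_deg {l : ℕ} (hl : l ≤ 2 * S.n) {ω : Ω} (hω : ω ∈ C.deg l) :
    S.hodge ω ∈ C.deg (2 * S.n - l) := by
  have key : S.hodge ∘ₗ GradedAlgebra.proj C.deg l =
      GradedAlgebra.proj C.deg (2 * S.n - l) ∘ₗ S.hodge := by
    refine S.ext_lefschetz fun a b j h ω hω => ?_
    simp only [LinearMap.comp_apply]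
    have h1 := S.bideg_le _ _ (S.lefschetz_pow_mem j (S.mem_prim hω).1)
    have h2 := S.bideg_le _ _ (S.hodge_lefschetz_mem h hω)
    by_cases hk : j + a + (j + b) = l
    · rw [hk] at h1
      rw [show S.n - j - b + (S.n - j - a) = 2 * S.n - l by omega] at h2
      rw [C.proj_of_mem h1, C.proj_of_mem h2]
    · rw [C.proj_of_mem_ne h1 hk, C.proj_of_mem_ne h2 (by omega), map_zero]
  have := LinearMap.congr_fun key ω
  simp only [LinearMap.comp_apply, C.proj_of_mem hω] at this
  rw [this, GradedAlgebra.proj_apply]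
  exact SetLike.coe_mem _

/-! ### The coefficient of a form with respect to the volume form -/

/-- The coefficient in `B` of the component of top degree of a form: `∗` sends the forms of degree
`2n` to `Ω⁰ = B`, and `toBase` discards all other components. -/
def vol : Ω →ₗ[ℂ] B := C.toBase ∘ₗ S.hodge

theorem vol_incl_mul (b : B) (ω : Ω) : S.vol (C.incl b * ω) = b * S.vol ω := by
  simp only [vol, LinearMap.comp_apply, S.hodge_incl_mul, C.toBase_incl_mul]

/-- Only the `(n, n)`-component of a form contributes to `vol`. -/
theorem vol_of_mem_ne {a b : ℕ} {ω : Ω} (hω : ω ∈ S.bideg (a, b)) (h : (a, b) ≠ (S.n, S.n)) :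
    S.vol ω = 0 := by
  have key : S.vol = S.vol ∘ₗ GradedAlgebra.proj S.bideg (S.n, S.n) := by
    refine S.ext_lefschetz fun a b j h ω hω => ?_
    have h1 := S.lefschetz_pow_mem j (S.mem_prim hω).1
    by_cases he : (j + a, j + b) = (S.n, S.n)
    · rw [he] at h1
      rw [LinearMap.comp_apply, S.proj_of_mem h1]
    · rw [LinearMap.comp_apply, S.proj_of_mem_ne h1 he, map_zero]
      refine C.toBase_of_mem_ne (S.bideg_le _ _ (S.hodge_lefschetz_mem h hω)) ?_
      rw [Prod.mk.injEq] at he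
      omega
  rw [key, LinearMap.comp_apply, S.proj_of_mem_ne hω h, map_zero]

theorem vol_of_mem_deg_ne {k : ℕ} {ω : Ω} (hω : ω ∈ C.deg k) (h : k ≠ 2 * S.n) :
    S.vol ω = 0 := by
  by_cases hk : k ≤ 2 * S.n
  · exact C.toBase_of_mem_ne (S.hodge_mem_deg hk hω) (by omega)
  · rw [S.deg_gt k (by omega), Submodule.mem_bot] at hω
    rw [hω, map_zero]

theorem vol_grading (ω : Ω) : S.vol (S.grading ω) = S.vol ω := by
  induction ω using DirectSum.Decomposition.inductionOn C.deg with
  | zero => simp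
  | add x y hx hy => simp only [map_add, hx, hy]
  | @homogeneous k x =>
    rw [S.grading_of_mem_deg x.2, map_smul]
    by_cases hk : k = 2 * S.n
    · rw [(hk ▸ even_two_mul S.n : Even k).neg_one_pow, one_smul]
    · rw [S.vol_of_mem_deg_ne x.2 hk, smul_zero]

/-- The terms of mixed degree being irrelevant, the metric is `vol (ω ∧ ∗(ν^*))` for all forms. -/
theorem metric_eq (ω ν : Ω) : S.metric ω ν = S.vol (ω * S.hodge (C.conj ν)) := by
  change ∑ k ∈ Finset.range (2 * S.n + 1), S.vol (GradedAlgebra.proj C.deg k ω *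
        S.hodge (C.conj (GradedAlgebra.proj C.deg k ν))) = _
  induction ω using DirectSum.Decomposition.inductionOn C.deg with
  | zero => simp
  | add x y hx hy => simp only [map_add, add_mul, Finset.sum_add_distrib, hx, hy]
  | @homogeneous k x =>
    induction ν using DirectSum.Decomposition.inductionOn C.deg with
    | zero => simp
    | add x y hx hy => simp only [map_add, mul_add, Finset.sum_add_distrib, hx, hy]
    | @homogeneous l y =>
      by_cases hl : l ≤ 2 * S.n
      · rw [Finset.sum_eq_single_of_mem l (Finset.mem_range.2 (by omega))]
        · rw [C.proj_of_mem y.2]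
          by_cases hk : k = l
          · subst hk
            rw [C.proj_of_mem x.2]
          · rw [C.proj_of_mem_ne x.2 hk, zero_mul, map_zero]
            symm
            exact S.vol_of_mem_deg_ne (SetLike.mul_mem_graded x.2
              (S.hodge_mem_deg hl (S.conj_mem_deg y.2))) (by omega)
        · intro m _ hm
          rw [C.proj_of_mem_ne y.2 (Ne.symm hm)]
          simp
      · have hy : (y : Ω) = 0 := by
          rw [← Submodule.mem_bot ℂ, ← S.deg_gt l (by omega)]
          exact y.2
        simp [hy]

/-! ### Formal adjoints of graded derivations -/

theorem leibniz_grading (ω ν : Ω) : C.d (ω * ν) = C.d ω * ν + S.grading ω * C.d ν := by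
  induction ω using DirectSum.Decomposition.inductionOn C.deg with
  | zero => simp
  | add x y hx hy => simp only [map_add, add_mul, hx, hy]; abel
  | @homogeneous k x =>
    rw [C.leibniz k _ x.2, S.grading_of_mem_deg x.2, smul_mul_assoc]

/-- The exterior derivative of an `(a, b)`-form has components of bidegrees `(a + 1, b)` and
`(a, b + 1)` only. -/
theorem d_components {a b : ℕ} {ω : Ω} (hω : ω ∈ S.bideg (a, b)) :
    S.del ω ∈ S.bideg (a + 1, b) ∧ S.delBar ω ∈ S.bideg (a, b + 1) ∧
      C.d ω = S.del ω + S.delBar ω := by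
  obtain ⟨x, hx, y, hy, hxy⟩ := Submodule.mem_sup.1 (S.integrable a b ω hω)
  have h1 : S.del ω = x := by
    rw [ComplexStructure.del, S.piecewise_apply _ hω, LinearMap.comp_apply, ← hxy, map_add,
      S.proj_of_mem hx, S.proj_of_mem_ne hy (by simp), add_zero]
  have h2 : S.delBar ω = y := by
    rw [ComplexStructure.delBar, S.piecewise_apply _ hω, LinearMap.comp_apply, ← hxy, map_add,
      S.proj_of_mem hy, S.proj_of_mem_ne hx (by simp), zero_add]
  rw [h1, h2]
  exact ⟨hx, hy, hxy.symm⟩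

theorem d_eq_del_add_delBar : C.d = S.del + S.delBar := by
  refine LinearMap.ext fun ω => ?_
  induction ω using S.bideg_induction with
  | zero => simp
  | add x y hx hy => rw [map_add, map_add, hx, hy]
  | mem a b ω hω => exact (S.d_components hω).2.2

section Component

variable {T T' : Ω →ₗ[ℂ] Ω} {s t s' t' : ℕ}

/-- A component of `d` of fixed bidegree inherits the Leibniz rule. -/
theorem leibniz_component (hd : C.d = T + T') (hne : (s, t) ≠ (s', t'))
    (hT : ∀ a b, ∀ ω ∈ S.bideg (a, b), T ω ∈ S.bideg (a + s, b + t))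
    (hT' : ∀ a b, ∀ ω ∈ S.bideg (a, b), T' ω ∈ S.bideg (a + s', b + t')) (ω ν : Ω) :
    T (ω * ν) = T ω * ν + S.grading ω * T ν := by
  induction ω using S.bideg_induction with
  | zero => simp
  | add x y hx hy => simp only [map_add, add_mul, hx, hy]; abel
  | mem a b ω hω =>
  induction ν using S.bideg_induction with
  | zero => simp
  | add x y hx hy => simp only [map_add, mul_add, hx, hy]; abel
  | mem c e ν hν =>
  have hm : ∀ {p q : ℕ × ℕ} {x y : Ω}, x ∈ S.bideg p → y ∈ S.bideg q → x * y ∈ S.bideg (p + q) :=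
    fun hx hy => SetLike.mul_mem_graded hx hy
  have hg : S.grading ω ∈ S.bideg (a, b) := by
    rw [S.grading_of_mem hω]; exact Submodule.smul_mem _ _ hω
  have h := S.leibniz_grading ω ν
  rw [hd] at h
  simp only [LinearMap.add_apply, add_mul, mul_add] at h
  -- Compare the components of this bidegree in the Leibniz rule for `d`.
  have h' := congrArg (GradedAlgebra.proj S.bideg (a + c + s, b + e + t)) h
  have hne' : s ≠ s' ∨ t ≠ t' := by
    rw [ne_eq, Prod.mk.injEq] at hne
    omega
  have m1 : T (ω * ν) ∈ S.bideg (a + c + s, b + e + t) := hT _ _ _ (hm hω hν)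
  have m2 : T' (ω * ν) ∈ S.bideg (a + c + s', b + e + t') := hT' _ _ _ (hm hω hν)
  have m3 : T ω * ν ∈ S.bideg (a + c + s, b + e + t) := by
    convert hm (hT _ _ _ hω) hν using 2
    simp only [Prod.mk_add_mk, Prod.mk.injEq]; omega
  have m4 : T' ω * ν ∈ S.bideg (a + c + s', b + e + t') := by
    convert hm (hT' _ _ _ hω) hν using 2
    simp only [Prod.mk_add_mk, Prod.mk.injEq]; omega
  have m5 : S.grading ω * T ν ∈ S.bideg (a + c + s, b + e + t) := by
    convert hm hg (hT _ _ _ hν) using 2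
    simp only [Prod.mk_add_mk, Prod.mk.injEq]; omega
  have m6 : S.grading ω * T' ν ∈ S.bideg (a + c + s', b + e + t') := by
    convert hm hg (hT' _ _ _ hν) using 2
    simp only [Prod.mk_add_mk, Prod.mk.injEq]; omega
  have hn : (a + c + s', b + e + t') ≠ (a + c + s, b + e + t) := by
    rw [ne_eq, Prod.mk.injEq]
    omega
  simpa only [map_add, S.proj_of_mem m1, S.proj_of_mem_ne m2 hn, S.proj_of_mem m3,
    S.proj_of_mem_ne m4 hn, S.proj_of_mem m5, S.proj_of_mem_ne m6 hn, add_zero] using h'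

/-- A component of `d` of fixed bidegree inherits the closedness of the integral. -/
theorem closed_component (hd : C.d = T + T') (hne : (s, t) ≠ (s', t'))
    (hT : ∀ a b, ∀ ω ∈ S.bideg (a, b), T ω ∈ S.bideg (a + s, b + t))
    (hT' : ∀ a b, ∀ ω ∈ S.bideg (a, b), T' ω ∈ S.bideg (a + s', b + t')) {χ : B →ₗ[ℂ] ℂ}
    (hχ : ∀ ω, χ (S.vol (C.d ω)) = 0) (ω : Ω) : χ (S.vol (T ω)) = 0 := by
  induction ω using S.bideg_induction with
  | zero => simp
  | add x y hx hy => simp only [map_add, hx, hy, add_zero]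
  | mem a b ω hω =>
    by_cases h : (a + s, b + t) = (S.n, S.n)
    · have h' : (a + s', b + t') ≠ (S.n, S.n) := by
        rw [ne_eq, Prod.mk.injEq] at *
        omega
      have := hχ ω
      rwa [hd, LinearMap.add_apply, map_add, S.vol_of_mem_ne (hT' _ _ _ hω) h', add_zero] at this
    · rw [S.vol_of_mem_ne (hT _ _ _ hω) h, map_zero]

end Component

theorem leibniz_del (ω ν : Ω) : S.del (ω * ν) = S.del ω * ν + S.grading ω * S.del ν :=
  S.leibniz_component (s := 1) (t := 0) (s' := 0) (t' := 1) S.d_eq_del_add_delBar (by simp)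
    (fun _ _ _ h => (S.d_components h).1) (fun _ _ _ h => (S.d_components h).2.1) ω ν

theorem leibniz_delBar (ω ν : Ω) :
    S.delBar (ω * ν) = S.delBar ω * ν + S.grading ω * S.delBar ν :=
  S.leibniz_component (s := 0) (t := 1) (s' := 1) (t' := 0)
    (S.d_eq_del_add_delBar.trans (add_comm _ _)) (by simp)
    (fun _ _ _ h => (S.d_components h).2.1) (fun _ _ _ h => (S.d_components h).1) ω ν

theorem closed_del {χ : B →ₗ[ℂ] ℂ} (hχ : ∀ ω, χ (S.vol (C.d ω)) = 0) (ω : Ω) :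
    χ (S.vol (S.del ω)) = 0 :=
  S.closed_component (s := 1) (t := 0) (s' := 0) (t' := 1) S.d_eq_del_add_delBar (by simp)
    (fun _ _ _ h => (S.d_components h).1) (fun _ _ _ h => (S.d_components h).2.1) hχ ω

theorem closed_delBar {χ : B →ₗ[ℂ] ℂ} (hχ : ∀ ω, χ (S.vol (C.d ω)) = 0) (ω : Ω) :
    χ (S.vol (S.delBar ω)) = 0 :=
  S.closed_component (s := 0) (t := 1) (s' := 1) (t' := 0)
    (S.d_eq_del_add_delBar.trans (add_comm _ _)) (by simp)
    (fun _ _ _ h => (S.d_components h).2.1) (fun _ _ _ h => (S.d_components h).1) hχ ω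

/-- The codifferential `-∗T∗`, conjugated by the conjugation of forms, so that it is the formal
adjoint of `T` itself (for `T = ∂`, say, `-∗∂∗` alone is the adjoint of `∂̄`). -/
def codiff (T : Ω →ₗ[ℂ] Ω) : Ω →ₗ[ℂ] Ω :=
  -(C.conj ∘ₛₗ (S.hodge ∘ₗ T ∘ₗ S.hodge : Ω →ₗ[ℂ] Ω) ∘ₛₗ C.conj)

/-- Integration by parts: a graded derivation with closed integral has a formal adjoint. -/
theorem integral_metric_codiff {T : Ω →ₗ[ℂ] Ω}
    (hT : ∀ ω ν, T (ω * ν) = T ω * ν + S.grading ω * T ν) {χ : B →ₗ[ℂ] ℂ}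
    (hχ : ∀ ω, χ (S.vol (T ω)) = 0) (ω ν : Ω) :
    χ (S.metric (T ω) ν) = χ (S.metric ω (S.codiff T ν)) := by
  have h := hχ (ω * S.hodge (C.conj ν))
  -- As the top degree is even, the sign of the Leibniz rule can be moved to the second factor,
  -- where it is the square of the Hodge map.
  have e : S.vol (S.grading ω * T (S.hodge (C.conj ν))) =
      S.vol (ω * S.hodge (S.hodge (T (S.hodge (C.conj ν))))) := by
    rw [← S.vol_grading, S.grading_mul, S.grading_grading, S.hodge_hodge]
  rw [hT, map_add, map_add, e] at h
  rw [S.metric_eq, S.metric_eq, codiff]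
  simp only [LinearMap.neg_apply, LinearMap.comp_apply, map_neg, C.conj_conj, mul_neg]
  exact eq_neg_of_add_eq_zero_left h

end HermitianStructure

end Calculus

namespace HermitianSpace

variable {A H Ω : Type*}
  [Ring A] [HopfAlgebra ℂ A] [StarRing A] [StarModule ℂ A] [CQGA A]
  [Ring H] [HopfAlgebra ℂ H] [StarRing H] [StarModule ℂ H] [CQGA H]
  [Ring Ω] [Algebra ℂ Ω] (X : HermitianSpace A H Ω)

/-! ### Covariance of the Hodge map and of the conjugation -/

/-- The operator on forms obtained by slicing the coaction with a functional on `A`. -/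
def sliceOp (φ : A →ₗ[ℂ] ℂ) : Ω →ₗ[ℂ] Ω := sliceLeft φ ∘ₗ X.coact.toLinearMap

theorem sliceOp_mem_bideg (φ : A →ₗ[ℂ] ℂ) (p : ℕ × ℕ) {ω : Ω} (hω : ω ∈ X.herm.bideg p) :
    X.sliceOp φ ω ∈ X.herm.bideg p :=
  sliceLeft_mem φ _ (X.coact_bideg p ω hω)

theorem coact_mem_deg {k : ℕ} {ω : Ω} (hω : ω ∈ X.calculus.deg k) :
    X.coact ω ∈ LinearMap.range ((X.calculus.deg k).subtype.lTensor A) := by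
  have : X.calculus.deg k ≤
      (LinearMap.range ((X.calculus.deg k).subtype.lTensor A)).comap X.coact.toLinearMap := by
    conv_lhs => rw [X.herm.deg_eq]
    refine iSup₂_le fun p hp ω hω => ?_
    obtain ⟨t, ht⟩ := X.coact_bideg p ω hω
    have hle : X.herm.bideg p ≤ X.calculus.deg k := by
      rw [← hp]; exact X.herm.bideg_le p.1 p.2
    refine ⟨(Submodule.inclusion hle).lTensor A t, ?_⟩
    rw [← LinearMap.comp_apply, ← LinearMap.lTensor_comp]
    exact ht
  exact this hω

theorem sliceOp_mem_deg (φ : A →ₗ[ℂ] ℂ) {k : ℕ} {ω : Ω} (hω : ω ∈ X.calculus.deg k) :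
    X.sliceOp φ ω ∈ X.calculus.deg k :=
  sliceLeft_mem φ _ (X.coact_mem_deg hω)

theorem sliceOp_σ_mul (φ : A →ₗ[ℂ] ℂ) (ω : Ω) :
    X.sliceOp φ (X.herm.σ * ω) = X.herm.σ * X.sliceOp φ ω := by
  have key : ∀ t : A ⊗[ℂ] Ω,
      sliceLeft φ ((1 ⊗ₜ[ℂ] X.herm.σ) * t) = X.herm.σ * sliceLeft φ t := by
    intro t
    induction t with
    | zero => simp
    | tmul a w => simp
    | add x y hx hy => simp only [mul_add, map_add, hx, hy]
  have h := key (X.coact ω)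
  rw [← X.coact_σ, ← map_mul] at h
  exact h

/-- The Hodge map is covariant: it commutes with all slices of the coaction. -/
theorem coact_hodge (ω : Ω) : X.coact (X.herm.hodge ω) = X.herm.hodge.lTensor A (X.coact ω) := by
  refine eq_of_sliceLeft_eq fun φ => ?_
  rw [sliceLeft_lTensor]
  exact (X.herm.hodge_comm (f := X.sliceOp φ) (fun a b ω hω => X.sliceOp_mem_bideg φ _ hω)
    (X.sliceOp_σ_mul φ) ω).symm

theorem coact_proj (k : ℕ) (ω : Ω) : X.coact (GradedAlgebra.proj X.calculus.deg k ω) =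
    (GradedAlgebra.proj X.calculus.deg k).lTensor A (X.coact ω) := by
  refine eq_of_sliceLeft_eq fun φ => ?_
  rw [sliceLeft_lTensor]
  change X.sliceOp φ _ = GradedAlgebra.proj X.calculus.deg k (X.sliceOp φ ω)
  induction ω using DirectSum.Decomposition.inductionOn X.calculus.deg with
  | zero => simp
  | add x y hx hy => simp only [map_add, hx, hy]
  | @homogeneous l x =>
    have hx := X.sliceOp_mem_deg φ x.2
    by_cases h : l = k
    · subst h
      rw [X.calculus.proj_of_mem x.2, X.calculus.proj_of_mem hx]
    · rw [X.calculus.proj_of_mem_ne x.2 h, X.calculus.proj_of_mem_ne hx h, map_zero]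

/-- The component of degree zero of a form, as an element of `A`. -/
def toAlg : Ω →ₗ[ℂ] A := (X.B.subtype : X.B →ₗ[ℂ] A) ∘ₗ X.calculus.toBase

theorem comul_toAlg (ω : Ω) :
    Coalgebra.comul (R := ℂ) (X.toAlg ω) = X.toAlg.lTensor A (X.coact ω) := by
  obtain ⟨x, hx, hx'⟩ := X.coact_incl (X.calculus.toBase ω)
  have h1 : X.toAlg ∘ₗ X.calculus.incl.toLinearMap = (X.B.subtype : X.B →ₗ[ℂ] A) :=
    LinearMap.ext fun b => congrArg Subtype.val (X.calculus.toBase_incl b)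
  have h2 : X.toAlg ∘ₗ GradedAlgebra.proj X.calculus.deg 0 = X.toAlg := by
    refine LinearMap.ext fun ω => ?_
    rw [LinearMap.comp_apply, ← X.calculus.incl_toBase]
    exact congrArg Subtype.val (X.calculus.toBase_incl _)
  rw [X.calculus.incl_toBase, X.coact_proj] at hx'
  have h := congrArg (X.toAlg.lTensor A) hx'
  rw [← LinearMap.comp_apply, ← LinearMap.comp_apply, ← LinearMap.lTensor_comp,
    ← LinearMap.lTensor_comp, h1, h2, hx] at h
  exact h.symm

/-- The coefficient of a form with respect to the volume form, with values in `A`. -/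
def volAlg : Ω →ₗ[ℂ] A := X.toAlg ∘ₗ X.herm.hodge

/-- The functional `ε ∘ vol` on forms. -/
def volCounit : Ω →ₗ[ℂ] ℂ := Coalgebra.counit ∘ₗ X.volAlg

/-- By covariance and the counit axiom, `vol` is determined by its composition with `ε`. -/
theorem volAlg_eq_slice (ω : Ω) : X.volAlg ω = sliceRight X.volCounit (X.coact ω) := by
  have h := congrArg (TensorProduct.rid ℂ A)
    (Coalgebra.lTensor_counit_comul (R := ℂ) (X.volAlg ω))
  rw [TensorProduct.rid_tmul, one_smul, volAlg, LinearMap.comp_apply, comul_toAlg, coact_hodge,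
    ← LinearMap.comp_apply (LinearMap.lTensor A X.toAlg), ← LinearMap.lTensor_comp] at h
  exact h.symm.trans (sliceRight_lTensor _ _ _)

/-- The conjugate linear map `* ⊗ *` on `A ⊗ Ω`. -/
def tensorConj : A ⊗[ℂ] Ω →ₗ⋆[ℂ] A ⊗[ℂ] Ω :=
  TensorProduct.map (starLinearEquiv ℂ (A := A)).toLinearMap X.calculus.conj

@[simp] theorem tensorConj_tmul (a : A) (ω : Ω) :
    X.tensorConj (a ⊗ₜ[ℂ] ω) = star a ⊗ₜ[ℂ] X.calculus.conj ω := rfl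

theorem tensorConj_mul {k l : ℕ} {s t : A ⊗[ℂ] Ω}
    (hs : s ∈ LinearMap.range ((X.calculus.deg k).subtype.lTensor A))
    (ht : t ∈ LinearMap.range ((X.calculus.deg l).subtype.lTensor A)) :
    X.tensorConj (s * t) = (-1 : ℂ) ^ (k * l) • (X.tensorConj t * X.tensorConj s) := by
  obtain ⟨s, rfl⟩ := hs
  obtain ⟨t, rfl⟩ := ht
  induction s with
  | zero => simp
  | add x y hx hy => simp only [map_add, add_mul, mul_add, smul_add, hx, hy]
  | tmul a w =>
    induction t with
    | zero => simp
    | add x y hx hy => simp only [map_add, add_mul, mul_add, smul_add, hx, hy]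
    | tmul b u =>
      simp [X.calculus.conj_mul k l _ w.2 _ u.2, TensorProduct.tmul_smul]

theorem coact_conj_incl (b : X.B) : X.coact (X.calculus.conj (X.calculus.incl b)) =
    X.tensorConj (X.coact (X.calculus.incl b)) := by
  obtain ⟨x, hx, hx'⟩ := X.coact_incl b
  obtain ⟨y, hy, hy'⟩ := X.coact_incl (star b)
  have h1 : ∀ z : A ⊗[ℂ] X.B, (X.B.subtype : X.B →ₗ[ℂ] A).lTensor A (star z) =
      star ((X.B.subtype : X.B →ₗ[ℂ] A).lTensor A z) := by
    intro z
    induction z with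
    | zero => simp
    | tmul a c => simp [TensorProduct.star_tmul]
    | add z z' h h' => simp only [star_add, map_add, h, h']
  have h2 : ∀ z : A ⊗[ℂ] X.B, X.calculus.incl.toLinearMap.lTensor A (star z) =
      X.tensorConj (X.calculus.incl.toLinearMap.lTensor A z) := by
    intro z
    induction z with
    | zero => simp
    | tmul a c => simp [TensorProduct.star_tmul, X.calculus.conj_incl]
    | add z z' h h' => simp only [star_add, map_add, h, h']
  -- Tensoring with `A` preserves the injectivity of the inclusion of `B` into `A`.
  have hyx : y = star x := by
    refine Module.Flat.lTensor_preserves_injective_linearMap (M := A)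
      (X.B.subtype : X.B →ₗ[ℂ] A) Subtype.val_injective ?_
    rw [h1, hx, hy, ← CQGA.comul_star]
    rfl
  rw [X.calculus.conj_incl, hy', hyx, h2, hx']

/-- The conjugation of forms is covariant, since the calculus is generated in degree zero. -/
theorem coact_conj (ω : Ω) : X.coact (X.calculus.conj ω) = X.tensorConj (X.coact ω) := by
  have h0 : ∀ ω ∈ X.calculus.deg 0, X.coact (X.calculus.conj ω) = X.tensorConj (X.coact ω) := by
    intro ω hω
    rw [← X.calculus.range_incl] at hω
    obtain ⟨b, rfl⟩ := hω
    exact X.coact_conj_incl b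
  have hd : ∀ t : A ⊗[ℂ] Ω, X.calculus.d.lTensor A (X.tensorConj t) =
      X.tensorConj (X.calculus.d.lTensor A t) := by
    intro t
    induction t with
    | zero => simp
    | tmul a w => simp [X.calculus.conj_d]
    | add x y hx hy => simp only [map_add, hx, hy]
  have hω : ω ∈ Submodule.span ℂ (Submonoid.closure ((X.calculus.deg 0 : Set Ω) ∪
      X.calculus.d '' (X.calculus.deg 0 : Set Ω)) : Set Ω) := by
    rw [← Algebra.adjoin_eq_span, X.calculus.generated]
    trivial
  induction hω using Submodule.span_induction with
  | zero => simp
  | add x y _ _ hx hy => simp only [map_add, hx, hy]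
  | smul c x _ hx => simp only [map_smul, map_smulₛₗ, hx]
  | mem x hx =>
    suffices h : ∃ k, x ∈ X.calculus.deg k ∧
        X.coact (X.calculus.conj x) = X.tensorConj (X.coact x) from h.choose_spec.2
    induction hx using Submonoid.closure_induction with
    | one => exact ⟨0, SetLike.one_mem_graded _, h0 _ (SetLike.one_mem_graded _)⟩
    | mem x hx =>
      rcases hx with hx | ⟨y, hy, rfl⟩
      · exact ⟨0, hx, h0 x hx⟩
      · refine ⟨0 + 1, X.calculus.d_mem 0 y hy, ?_⟩
        rw [← X.calculus.conj_d, X.coact_d, h0 y hy, hd, X.coact_d]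
    | mul x y _ _ hx hy =>
      obtain ⟨k, hk, ex⟩ := hx
      obtain ⟨l, hl, ey⟩ := hy
      refine ⟨k + l, SetLike.mul_mem_graded hk hl, ?_⟩
      rw [X.calculus.conj_mul k l x hk y hl, map_smul, map_mul, map_mul, ex, ey,
        X.tensorConj_mul (X.coact_mem_deg hk) (X.coact_mem_deg hl)]

/-! ### The fibre of the metric at the unit -/

theorem coe_metric (ω ν : Ω) : ((X.herm.metric ω ν : X.B) : A) =
    X.volAlg (ω * X.herm.hodge (X.calculus.conj ν)) :=
  congrArg Subtype.val (X.herm.metric_eq ω ν)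

/-- The sesquilinear form `ε(g_σ(ω, ν))`: the metric at the fibre over the unit. -/
def fibreForm : Ω →ₗ[ℂ] Ω →ₗ⋆[ℂ] ℂ :=
  LinearMap.mk₂'ₛₗ (RingHom.id ℂ) (starRingEnd ℂ)
    (fun ω ν => Coalgebra.counit (R := ℂ) ((X.herm.metric ω ν : X.B) : A))
    (fun ω ω' ν => by simp)
    (fun r ω ν => by simp)
    (fun ω ν ν' => by simp)
    (fun r ω ν => by simp)

theorem fibreForm_apply (ω ν : Ω) :
    X.fibreForm ω ν = X.volCounit (ω * X.herm.hodge (X.calculus.conj ν)) := by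
  change Coalgebra.counit (R := ℂ) ((X.herm.metric ω ν : X.B) : A) = _
  rw [X.coe_metric]
  rfl

theorem fibreForm_nonneg (ω : Ω) : 0 ≤ X.fibreForm ω ω := by
  by_cases hω : ω = 0
  · simp [hω]
  obtain ⟨-, l, b, hb⟩ := X.positive ω hω
  change 0 ≤ Coalgebra.counit (R := ℂ) ((X.herm.metric ω ω : X.B) : A)
  have hval : ((X.herm.metric ω ω : X.B) : A) = ∑ i, star (b i : A) * (b i : A) := by
    rw [hb]
    simp
  rw [hval, map_sum]
  refine Finset.sum_nonneg fun i _ => ?_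
  rw [Bialgebra.counit_mul, counit_star]
  exact star_mul_self_nonneg (Coalgebra.counit (R := ℂ) (b i : A))

/-- As the Hodge map and the conjugation are bijective, the radical of the form at the unit is the
radical of the bilinear form `ε(vol (ω ∧ ν))`. -/
theorem mem_ker_fibreForm {ω : Ω} :
    ω ∈ LinearMap.ker X.fibreForm ↔ ∀ ν, X.volCounit (ω * ν) = 0 := by
  refine ⟨fun h ν => ?_, fun h => LinearMap.ext fun ν => ?_⟩
  · have := LinearMap.congr_fun (LinearMap.mem_ker.1 h)
      (X.calculus.conj (X.herm.hodge (X.herm.grading ν)))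
    rwa [X.fibreForm_apply, X.calculus.conj_conj, X.herm.hodge_hodge, X.herm.grading_grading]
      at this
  · rw [X.fibreForm_apply]
    exact h _

/-- The radical of the form at the unit is a right ideal. -/
theorem mul_mem_ker_fibreForm {ω : Ω} (h : ω ∈ LinearMap.ker X.fibreForm) (η : Ω) :
    ω * η ∈ LinearMap.ker X.fibreForm :=
  X.mem_ker_fibreForm.2 fun ν => by
    rw [mul_assoc]
    exact X.mem_ker_fibreForm.1 h _

theorem augmentation_mul_mem_ker {b : X.B} (hb : Coalgebra.counit (R := ℂ) (b : A) = 0) (ω : Ω) :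
    X.calculus.incl b * ω ∈ LinearMap.ker X.fibreForm := by
  refine X.mem_ker_fibreForm.2 fun ν => ?_
  have h : X.volAlg (X.calculus.incl b * (ω * ν)) = (b : A) * X.volAlg (ω * ν) :=
    congrArg Subtype.val (X.herm.vol_incl_mul b (ω * ν))
  rw [mul_assoc, volCounit, LinearMap.comp_apply, h, Bialgebra.counit_mul, hb, zero_mul]

/-- `Ω B⁺ = B⁺ Ω` is contained in the radical. -/
theorem mul_augmentation_mem_ker {b : X.B} (hb : Coalgebra.counit (R := ℂ) (b : A) = 0) (ω : Ω) :
    ω * X.calculus.incl b ∈ LinearMap.ker X.fibreForm := by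
  have h : ω * X.calculus.incl b ∈ Submodule.span ℂ {x : Ω | ∃ (ω : Ω) (b : X.base.coinv),
      Coalgebra.counit (R := ℂ) (b : A) = 0 ∧ x = ω * X.calculus.incl b} :=
    Submodule.subset_span ⟨ω, b, hb, rfl⟩
  rw [X.mul_augmentation] at h
  refine Submodule.span_le.2 ?_ h
  rintro - ⟨b, ω, hb, rfl⟩
  exact X.augmentation_mul_mem_ker hb ω

theorem counit_sub_counit (b : X.B) : Coalgebra.counit (R := ℂ)
    ((b - Coalgebra.counit (R := ℂ) (b : A) • (1 : X.B) : X.B) : A) = 0 := by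
  simp

/-- The radical has finite codimension, since `Ω` is finitely generated over `B` and the radical
contains `B⁺ Ω`. -/
theorem exists_ker_sup_span_eq_top : ∃ s : Finset Ω,
    LinearMap.ker X.fibreForm ⊔ Submodule.span ℂ (s : Set Ω) = ⊤ := by
  obtain ⟨s, hs⟩ := X.finite
  refine ⟨s, eq_top_iff.2 fun ω _ => ?_⟩
  obtain ⟨c, hc⟩ := hs ω
  rw [hc]
  refine Submodule.sum_mem _ fun x hx => ?_
  have e : X.calculus.incl (c x) * x =
      X.calculus.incl (c x - Coalgebra.counit (R := ℂ) (c x : A) • 1) * x +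
        Coalgebra.counit (R := ℂ) (c x : A) • x := by
    simp [sub_mul]
  rw [e]
  exact Submodule.add_mem _
    (Submodule.mem_sup_left (X.augmentation_mul_mem_ker (X.counit_sub_counit _) _))
    (Submodule.mem_sup_right (Submodule.smul_mem _ _ (Submodule.subset_span hx)))

/-! ### The forms as vectors with entries in `A` -/

/-- The forms embed isometrically into `A^r`, in such a way that right multiplication by a form `η`
becomes multiplication by a matrix `G η` with entries in `A`, and by the scalar matrix `b` for
`η = b ∈ B`. -/
theorem exists_coordinates : ∃ (r : ℕ) (F : Fin r → Ω → A) (G : Fin r → Fin r → Ω → A),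
    (∀ ω ν, ((X.herm.metric ω ν : X.B) : A) = ∑ i, F i ω * star (F i ν)) ∧
    (∀ i ω η, F i (ω * η) = ∑ j, F j ω * G i j η) ∧
    (∀ i j (b : X.B), G i j (X.calculus.incl b) = if i = j then (b : A) else 0) := by
  obtain ⟨s, hs⟩ := X.exists_ker_sup_span_eq_top
  obtain ⟨r, v, hv, hexp⟩ := exists_orthonormal_modulo_ker X.fibreForm_nonneg s hs
  -- The coordinate functionals vanish on the radical, which is a right ideal.
  let f : Fin r → Ω →ₗ[ℂ] ℂ := fun i => X.fibreForm.flip (v i)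
  have hf : ∀ i ω, f i ω = X.fibreForm ω (v i) := fun i ω => rfl
  have hker : ∀ i ω, ω ∈ LinearMap.ker X.fibreForm → f i ω = 0 := fun i ω h => by
    rw [hf, LinearMap.mem_ker.1 h, LinearMap.zero_apply]
  have hq : ∀ ω ν, X.fibreForm ω ν = ∑ i, f i ω * (starRingEnd ℂ) (f i ν) := by
    intro ω ν
    have h := LinearMap.congr_fun (LinearMap.mem_ker.1 (hexp ω)) ν
    rw [map_sub, map_sum, LinearMap.sub_apply, LinearMap.zero_apply, sub_eq_zero,
      LinearMap.sum_apply] at h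
    rw [h]
    refine Finset.sum_congr rfl fun i _ => ?_
    rw [map_smul, LinearMap.smul_apply, smul_eq_mul, hf, hf,
      conj_symm_of_nonneg X.fibreForm_nonneg]
  have hfmul : ∀ i ω η, f i (ω * η) = ∑ j, f j ω * f i (v j * η) := by
    intro i ω η
    have h := hker i _ (X.mul_mem_ker_fibreForm (hexp ω) η)
    rw [sub_mul, map_sub, sub_eq_zero, Finset.sum_mul, map_sum] at h
    rw [h]
    refine Finset.sum_congr rfl fun j _ => ?_
    rw [smul_mul_assoc, map_smul, smul_eq_mul, hf j]
  have hfincl : ∀ i j (b : X.B), f i (v j * X.calculus.incl b) =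
      if i = j then Coalgebra.counit (R := ℂ) (b : A) else 0 := by
    intro i j b
    have h := hker i _ (X.mul_augmentation_mem_ker (X.counit_sub_counit b) (v j))
    rw [map_sub, mul_sub, map_sub, sub_eq_zero, map_smul, map_one, mul_smul_comm, mul_one,
      map_smul, hf i (v j), hv] at h
    rw [h]
    simp [eq_comm (a := i)]
  refine ⟨r, fun i ω => sliceRight (f i) (X.coact ω),
    fun i j η => sliceRight (f i ∘ₗ LinearMap.mulLeft ℂ (v j)) (X.coact η), ?_, ?_, ?_⟩
  · intro ω ν
    rw [X.coe_metric, X.volAlg_eq_slice, map_mul, X.coact_hodge, X.coact_conj]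
    beta_reduce
    generalize X.coact ω = s
    generalize X.coact ν = t
    induction s with
    | zero => simp
    | add x y hx hy => simp only [map_add, add_mul, Finset.sum_add_distrib, hx, hy]
    | tmul a w =>
      induction t with
      | zero => simp
      | add x y hx hy => simp only [map_add, star_add, mul_add, Finset.sum_add_distrib, hx, hy]
      | tmul b u =>
        simp only [tensorConj_tmul, LinearMap.lTensor_tmul, Algebra.TensorProduct.tmul_mul_tmul,
          sliceRight_tmul]
        rw [← X.fibreForm_apply, hq, Finset.sum_smul]
        refine Finset.sum_congr rfl fun i _ => ?_
        rw [star_smul, smul_mul_smul_comm]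
        rfl
  · intro i ω η
    simp only [map_mul]
    generalize X.coact ω = s
    generalize X.coact η = t
    induction s with
    | zero => simp
    | add x y hx hy => simp only [map_add, add_mul, Finset.sum_add_distrib, hx, hy]
    | tmul a w =>
      induction t with
      | zero => simp
      | add x y hx hy => simp only [map_add, mul_add, Finset.sum_add_distrib, hx, hy]
      | tmul b u =>
        simp only [Algebra.TensorProduct.tmul_mul_tmul, sliceRight_tmul, LinearMap.comp_apply,
          LinearMap.mulLeft_apply, smul_mul_smul_comm]
        rw [hfmul, Finset.sum_smul]
  · intro i j b
    obtain ⟨x, hx, hx'⟩ := X.coact_incl b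
    have e : (f i ∘ₗ LinearMap.mulLeft ℂ (v j)) ∘ₗ X.calculus.incl.toLinearMap =
        (if i = j then (1 : ℂ) else 0) • (Coalgebra.counit ∘ₗ (X.B.subtype : X.B →ₗ[ℂ] A)) := by
      refine LinearMap.ext fun c => ?_
      simp only [LinearMap.comp_apply, LinearMap.mulLeft_apply, AlgHom.toLinearMap_apply, hfincl]
      split_ifs <;> simp
    have hb : sliceRight (Coalgebra.counit (R := ℂ)) (Coalgebra.comul (R := ℂ) (b : A)) =
        (b : A) := by
      simp [sliceRight]
    beta_reduce
    rw [hx', sliceRight_lTensor, e]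
    split_ifs with hij
    · rw [one_smul, ← sliceRight_lTensor, hx, hb]
    · simp [sliceRight]

/-! ### Right multiplication by forms -/

theorem norm_toL2_sq_eq_sum {r : ℕ} {F : Fin r → Ω → A}
    (hF : ∀ ω ν, ((X.herm.metric ω ν : X.B) : A) = ∑ i, F i ω * star (F i ν)) (ω : Ω) :
    ‖X.toL2 ω‖ ^ 2 = ∑ i, ‖(haarForm A).toHilbert (F i ω)‖ ^ 2 := by
  rw [X.innerForm.norm_toHilbert_sq]
  change (haar A ((X.herm.metric ω ω : X.B) : A)).re = _
  rw [hF, map_sum, Complex.re_sum]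
  exact Finset.sum_congr rfl fun i _ => ((haarForm A).norm_toHilbert_sq _).symm

/-- Right multiplication by a form is a matrix of right multiplications by elements of `A`, and is
therefore bounded. -/
theorem bounded_rightMul (η : Ω) : X.innerForm.Bounded (X.rightMul η) := by
  obtain ⟨r, F, G, hF, hG, -⟩ := X.exists_coordinates
  choose c hc0 hc using fun i j => (bounded_mulRight (G i j η)).exists_nonneg
  have hle : ∀ j ω, ‖(haarForm A).toHilbert (F j ω)‖ ≤ ‖X.toL2 ω‖ := fun j ω => by
    rw [← sq_le_sq₀ (norm_nonneg _) (norm_nonneg _), X.norm_toL2_sq_eq_sum hF]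
    exact Finset.single_le_sum (f := fun i => ‖(haarForm A).toHilbert (F i ω)‖ ^ 2)
      (fun i _ => sq_nonneg _) (Finset.mem_univ j)
  have hrow : ∀ i ω, ‖(haarForm A).toHilbert (F i (ω * η))‖ ≤ (∑ j, c i j) * ‖X.toL2 ω‖ := by
    intro i ω
    rw [hG, map_sum, Finset.sum_mul]
    refine (norm_sum_le _ _).trans (Finset.sum_le_sum fun j _ => ?_)
    exact (hc i j (F j ω)).trans (mul_le_mul_of_nonneg_left (hle j ω) (hc0 i j))
  refine ⟨√(∑ i, (∑ j, c i j) ^ 2), fun ω => ?_⟩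
  rw [← sq_le_sq₀ (norm_nonneg _) (by positivity), mul_pow,
    Real.sq_sqrt (Finset.sum_nonneg fun _ _ => sq_nonneg _), X.norm_toL2_sq_eq_sum hF,
    Finset.sum_mul]
  refine Finset.sum_le_sum fun i _ => ?_
  rw [← mul_pow]
  exact pow_le_pow_left₀ (norm_nonneg _) (hrow i ω) 2

/-- Right multiplication by `b ∈ B` acts on the coordinates of a form as right multiplication by
`b` on each of them. -/
theorem norm_rightMul_incl_le (b : X.B) (ω : Ω) :
    ‖X.toL2 (X.rightMul (X.calculus.incl b) ω)‖ ≤ redNorm A (b : A) * ‖X.toL2 ω‖ := by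
  obtain ⟨r, F, G, hF, hG, hGb⟩ := X.exists_coordinates
  have hred : 0 ≤ redNorm A (b : A) := norm_nonneg _
  rw [← sq_le_sq₀ (norm_nonneg _) (by positivity), mul_pow, X.norm_toL2_sq_eq_sum hF,
    X.norm_toL2_sq_eq_sum hF, Finset.mul_sum]
  refine Finset.sum_le_sum fun i _ => ?_
  have h : F i (X.rightMul (X.calculus.incl b) ω) = F i ω * (b : A) := by
    change F i (ω * X.calculus.incl b) = _
    rw [hG]
    simp [hGb]
  rw [h, ← mul_pow]
  exact pow_le_pow_left₀ (norm_nonneg _)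
    (PosForm.norm_toHilbert_le_extend (bounded_mulRight (b : A)) (F i ω)) 2

theorem isAdjoint_rightMul_incl (b : X.B) : X.innerForm.IsAdjoint
    (X.rightMul (X.calculus.incl b)) (X.rightMul (X.calculus.incl (star b))) := fun ω ν => by
  change haar A ((X.herm.metric (ω * X.calculus.incl b) ν : X.B) : A) =
    haar A ((X.herm.metric ω (ν * X.calculus.incl (star b)) : X.B) : A)
  rw [X.coe_metric, X.coe_metric, X.calculus.conj_mul_incl, star_star, X.herm.hodge_incl_mul,
    mul_assoc]

/-- The representation of the opposite algebra of the forms on `L²(Ω)` by right multiplications. -/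
def rightRep : Ωᵐᵒᵖ →ₐ[ℂ] (X.L2 →L[ℂ] X.L2) where
  toFun η := X.innerForm.extend (X.rightMul η.unop)
  map_one' := PosForm.clm_ext fun x => by
    rw [X.innerForm.extend_toHilbert (X.bounded_rightMul _)]
    simp [rightMul]
  map_mul' η ζ := PosForm.clm_ext fun x => by
    rw [ContinuousLinearMap.mul_def, ContinuousLinearMap.comp_apply]
    simp only [X.innerForm.extend_toHilbert (X.bounded_rightMul _)]
    simp [rightMul, mul_assoc]
  map_zero' := PosForm.clm_ext fun x => by
    rw [X.innerForm.extend_toHilbert (X.bounded_rightMul _)]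
    simp [rightMul]
  map_add' η ζ := PosForm.clm_ext fun x => by
    rw [add_apply]
    simp only [X.innerForm.extend_toHilbert (X.bounded_rightMul _)]
    simp [rightMul, mul_add]
  commutes' c := PosForm.clm_ext fun x => by
    rw [X.innerForm.extend_toHilbert (X.bounded_rightMul _)]
    simp [rightMul, Algebra.algebraMap_eq_smul_one]

theorem rightRep_toL2 (η ν : Ω) :
    X.rightRep (MulOpposite.op η) (X.toL2 ν) = X.toL2 (X.rightMul η ν) :=
  X.innerForm.extend_toHilbert (X.bounded_rightMul η) ν

/-- The vector `1` is separating. -/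
theorem rightRep_injective : Function.Injective X.rightRep := by
  refine (injective_iff_map_eq_zero X.rightRep).2 fun η h => ?_
  have h1 := X.rightRep_toL2 η.unop 1
  rw [MulOpposite.op_unop, h, zero_apply, rightMul, LinearMap.mulRight_apply,
    one_mul] at h1
  rw [← MulOpposite.unop_eq_zero_iff]
  exact X.innerForm.toHilbert_injective (h1.symm.trans (map_zero _).symm)

/-! ### Commutators -/

/-- The restriction of the Haar functional to `B`. -/
def haarBase : X.B →ₗ[ℂ] ℂ := haar A ∘ₗ (X.B.subtype : X.B →ₗ[ℂ] A)

/-- The closedness of the integral, for forms of all degrees. -/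
theorem integral_d (ω : Ω) : X.haarBase (X.herm.vol (X.calculus.d ω)) = 0 := by
  induction ω using DirectSum.Decomposition.inductionOn X.calculus.deg with
  | zero => simp
  | add x y hx hy => simp only [map_add, hx, hy, add_zero]
  | @homogeneous k x =>
    by_cases hk : k + 1 = 2 * X.herm.n
    · exact X.integral_closed k hk x x.2
    · rw [X.herm.vol_of_mem_deg_ne (X.calculus.d_mem k x x.2) hk, map_zero]

/-- The grading automorphism is isometric. -/
theorem bounded_grading : X.innerForm.Bounded X.herm.grading := by
  refine ⟨1, fun ω => ?_⟩
  have h : X.innerForm.form (X.herm.grading ω) (X.herm.grading ω) = X.innerForm.form ω ω := by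
    change X.haarBase (X.herm.metric _ _) = X.haarBase (X.herm.metric _ _)
    rw [X.herm.metric_eq, X.herm.metric_eq, ← X.herm.grading_conj, ← X.herm.grading_hodge,
      ← X.herm.grading_mul, X.herm.vol_grading]
  rw [one_mul, ← sq_le_sq₀ (norm_nonneg _) (norm_nonneg _), X.innerForm.norm_toHilbert_sq,
    X.innerForm.norm_toHilbert_sq, h]

variable {X} {T : Ω →ₗ[ℂ] Ω}

theorem isAdjoint_adjoint_of_closed
    (hT : ∀ ω ν, T (ω * ν) = T ω * ν + X.herm.grading ω * T ν)
    (hc : ∀ ω, X.haarBase (X.herm.vol (T ω)) = 0) :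
    X.innerForm.IsAdjoint T (X.innerForm.adjoint T) :=
  X.innerForm.isAdjoint_adjoint ⟨X.herm.codiff T, X.herm.integral_metric_codiff hT hc⟩

/-- The commutator of a graded derivation `T` with right multiplication by `b` is
`ω ↦ ± ω ∧ T b`. -/
theorem bounded_commutator (hT : ∀ ω ν, T (ω * ν) = T ω * ν + X.herm.grading ω * T ν)
    (b : X.B) : X.innerForm.Bounded (X.commutator T b) := by
  have h : X.commutator T b = X.rightMul (T (X.calculus.incl b)) ∘ₗ X.herm.grading :=
    LinearMap.ext fun ω => by simp [commutator, rightMul, hT]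
  rw [h]
  exact (X.bounded_rightMul _).comp X.bounded_grading

/-- If `S` is adjoint to `T`, then `-[S, R_b]` is adjoint to `[T, R_{b*}]`. -/
theorem bounded_commutator_of_isAdjoint {S : Ω →ₗ[ℂ] Ω} (h : X.innerForm.IsAdjoint T S)
    (hb : ∀ b, X.innerForm.Bounded (X.commutator T b)) (b : X.B) :
    X.innerForm.Bounded (X.commutator S b) := by
  have hR := (X.isAdjoint_rightMul_incl b).symm
  have key : X.innerForm.IsAdjoint (X.commutator T (star b)) (-X.commutator S b) := fun x y => by
    simp only [commutator, LinearMap.sub_apply, LinearMap.comp_apply, LinearMap.neg_apply, map_sub,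
      map_neg, h _ _, hR _ _]
    ring
  simpa using ((hb (star b)).of_isAdjoint key).neg

theorem bounded_commutators (hT : ∀ ω ν, T (ω * ν) = T ω * ν + X.herm.grading ω * T ν)
    (hc : ∀ ω, X.haarBase (X.herm.vol (T ω)) = 0) :
    X.innerForm.IsAdjoint T (X.innerForm.adjoint T) ∧
      ∀ b : X.B, X.innerForm.Bounded (X.commutator T b) ∧
        X.innerForm.Bounded (X.commutator (X.innerForm.adjoint T) b) ∧
        X.innerForm.Bounded (X.commutator (X.dirac T) b) := by
  have ha := isAdjoint_adjoint_of_closed hT hc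
  refine ⟨ha, fun b => ?_⟩
  have h1 := bounded_commutator hT b
  have h2 := bounded_commutator_of_isAdjoint ha (bounded_commutator hT) b
  refine ⟨h1, h2, ?_⟩
  have e : X.commutator (X.dirac T) b =
      X.commutator T b + X.commutator (X.innerForm.adjoint T) b := by
    simp only [commutator, dirac, LinearMap.add_comp, LinearMap.comp_add]
    abel
  rw [e]
  exact h1.add h2

end HermitianSpace

end CQH

end

theorem mainTheorem11 {A H Ω : Type*}
    [Ring A] [HopfAlgebra ℂ A] [StarRing A] [StarModule ℂ A] [CQH.CQGA A]
    [Ring H] [HopfAlgebra ℂ H] [StarRing H] [StarModule ℂ H] [CQH.CQGA H]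
    [Ring Ω] [Algebra ℂ Ω] (X : CQH.HermitianSpace A H Ω) :
    (∀ ω : Ω, X.innerForm.Bounded (X.rightMul ω)) ∧
    (∀ ω : Ω, ω ≠ 0 → X.rightMul ω ≠ 0) ∧
    (∃ ρ : Ωᵐᵒᵖ →ₐ[ℂ] (X.L2 →L[ℂ] X.L2),
      (∀ ω ν : Ω, ρ (MulOpposite.op ω) (X.toL2 ν) = X.toL2 (X.rightMul ω ν)) ∧
      Function.Injective ρ ∧
      (∀ b : X.B, ρ (MulOpposite.op (X.calculus.incl (star b))) =
        ContinuousLinearMap.adjoint (ρ (MulOpposite.op (X.calculus.incl b)))) ∧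
      (∀ b : X.B, (CQH.haarForm A).Bounded (LinearMap.mulRight ℂ (b : A)) ∧
        ‖ρ (MulOpposite.op (X.calculus.incl b))‖ ≤ CQH.redNorm A (b : A))) ∧
    (∀ T ∈ ({X.calculus.d, X.herm.del, X.herm.delBar} : Set (Ω →ₗ[ℂ] Ω)),
      X.innerForm.IsAdjoint T (X.innerForm.adjoint T) ∧
      ∀ b : X.B, X.innerForm.Bounded (X.commutator T b) ∧
        X.innerForm.Bounded (X.commutator (X.innerForm.adjoint T) b) ∧
        X.innerForm.Bounded (X.commutator (X.dirac T) b)) := by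
  refine ⟨X.bounded_rightMul, fun ω hω h => hω ?_, ⟨X.rightRep, X.rightRep_toL2,
    X.rightRep_injective, fun b => ?_, fun b => ⟨CQH.bounded_mulRight _, ?_⟩⟩, ?_⟩
  · simpa [CQH.HermitianSpace.rightMul] using LinearMap.congr_fun h 1
  · exact CQH.PosForm.extend_adjoint (X.bounded_rightMul _) (X.isAdjoint_rightMul_incl b)
  · exact CQH.PosForm.norm_extend_le (norm_nonneg _) (X.norm_rightMul_incl_le b)
  · rintro T (rfl | rfl | rfl)
    · exact CQH.HermitianSpace.bounded_commutators X.herm.leibniz_grading X.integral_d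
    · exact CQH.HermitianSpace.bounded_commutators X.herm.leibniz_del
        (X.herm.closed_del X.integral_d)
    · exact CQH.HermitianSpace.bounded_commutators X.herm.leibniz_delBar
        (X.herm.closed_delBar X.integral_d)
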